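/- **Setting.** Let $\Omega=\{\xi\in[0,1]^3:\xi_1+\xi_2+\xi_3\le 1\}$ be the unit tetrahedron with vertices $v_1=0$, $v_2=\mathbf e_3$, $v_3=\mathbf e_2$, $v_4=\mathbf e_1$. Its polytopes are its vertices, edges, faces and its cell, indexed by the nonempty sets $s\subseteq\{1,2,3,4\}$ of their vertices. Let $p\ge1$ and let $U^p$ be a basis of the polynomials of degree at most $p$ on $\Omega$ in which each polytope $s$ carries $\binom{p-1}{|s|-1}$ functions, each vanishing on every polytope $t\not\supseteq s$. The polytopal template consists of the lists $$\begin{aligned} &\mathcal T_1=(\mathbf e_3,\mathbf e_2,\mathbf e_1),\ \mathcal T_2=(\mathbf d,\mathbf e_2,\mathbf e_1),\ \mathcal T_3=(\mathbf d,-\mathbf e_3,\mathbf e_1),\ \mathcal T_4=(\mathbf d,-\mathbf e_3,-\mathbf e_2),\\ &\mathcal T_{12}=(\mathbf e_3,-\mathbf e_2,-\mathbf e_1),\ \mathcal T_{13}=(\mathbf e_2,\mathbf e_3,-\mathbf e_1),\ \mathcal T_{14}=(\mathbf e_1,\mathbf e_3,\mathbf e_2),\\ &\mathcal T_{23}=(\mathbf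 e_2,\mathbf d,-\mathbf e_1),\ \mathcal T_{24}=(\mathbf e_1,\mathbf d,\mathbf e_2),\ \mathcal T_{34}=(\mathbf e_1,\mathbf d,-\mathbf e_3),\\ &\mathcal T_{123}=(\mathbf e_3,\mathbf e_2,-\mathbf e_1),\ \mathcal T_{124}=(\mathbf e_3,\mathbf e_1,\mathbf e_2),\ \mathcal T_{134}=(\mathbf e_2,\mathbf e_1,-\mathbf e_3),\ \mathcal T_{234}=(\mathbf e_2,\mathbf e_1,\mathbf d),\\ &\mathcal T_{1234}=(\mathbf e_3,\mathbf e_2,\mathbf e_1),\qquad \mathbf d=\mathbf e_1+\mathbf e_2+\mathbf e_3 . \end{aligned}$$ The base functions of $\mathcal N_{II}^p$ are the products $\boldsymbol\vartheta=n\,\boldsymbol\ell$, where $n\in U^p$ belongs to a polytope $s$ and $\boldsymbol\ell\in\mathcal T_s$. Each is associated with a polytope $f\supseteq s$ as follows ($\tau$ denotes an edge tangent, $\nu$ a face normal): vertex-edge ($s$ a vertex, $f$ an edge: $\langle\tau_f,\boldsymbol\ell\rangle\ne0$); edge ($s=f$ an edge: $\langle\tau_f,\boldsymbol\ell\rangle\neq0$);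 edge-face ($s$ an edge, $f$ a face: $\langle\tau_s,\boldsymbol\ell\rangle=0$, $\nu_f\times\boldsymbol\ell\ne0$); face ($s=f$ a face: $\nu_f\times\boldsymbol\ell\neq0$); face-cell ($s$ a face, $f$ the cell: $\nu_s\times\boldsymbol\ell=0$); cell ($s=f$ the cell, all $\boldsymbol\ell$). Let $V\subset\mathbb R^3$ be open and let $\overline V=\bigcup_K \mathbf x_K(\Omega)$ be a finite conforming grid of (possibly curved) tetrahedra. Each $\mathbf x_K$ is $C^1$ on a neighbourhood of $\Omega$, injective on $\Omega$, with invertible Jacobi matrix $\mathbf J_K$ on $\Omega$. Two different elements have different vertex sets and meet exactly in the polytope spanned by their common vertices, on which their parametrisations agree in barycentric coordinates. The local vertices $v_1,\dots,v_4$ of each element are numbered by increasing global vertex number. For a polytope $S$ of the grid and $m\le\binom{p-1}{|S|-1}$, let $N_{S,m}$ be the function on $V$ which, on each element $K$ containing $S$, equals $n\circ\mathbf x_K^{-1}$, with $n$ the $m$-th base function of the corresponding polytope of $\Omega$, and which is zero on all other elements. For polytopes $S\subseteq F$ of the grid of one of the six kinds above, let $\boldsymbol\theta$ be the field which, on each element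 $K$ containing $F$, equals the covariant Piola transform $\boldsymbol\theta=(\mathbf J_K^{-T}\,n\boldsymbol\ell)\circ\mathbf x_K^{-1}$, with $\boldsymbol\ell$ the $r$-th admissible template vector in the order of the lists, and which is zero on all other elements. **Theorem.** Assume that $U^p$ is $H^1$-conforming on the grid, i.e. the span of the functions $N_{S,m}$ is contained in $H^1(V)$. Then the span of the fields $\boldsymbol\theta$ is contained in $H(\mathrm{curl},V)$. Moreover, let $\boldsymbol\theta$ be the base field given by $(S,F,m,r)$, let $N=N_{S,m}$, and on each closed element $K$ take the one-sided traces of both. Write $\mathbf t_{ab}=\mathbf J_K(v_b-v_a)$. 1. On each proper polytope $G$ of an element $K$ with $F\not\subseteq G$, the tangential trace of $\boldsymbol\theta$ vanishes: $\langle\mathbf t_{ab},\boldsymbol\theta\rangle=0$ on $G$ for all vertices $a,b$ of $G$. In particular, the tangential traces of face-cell and cell functions vanish on the whole element boundary. 2. If $F$ is the edge with vertices $a<b$ (in the global order), then $\langle\mathbf t_{ab},\boldsymbol\theta\rangle=N$ on $F$, on each element containing $F$. 3. If $F$ is a face, there are constants $c_{ab}$ for vertices $a,b$ of $F$, the same for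 all elements containing $F$, with $c_{ab}=1$ for at least one pair, such that $\langle\mathbf t_{ab},\boldsymbol\theta\rangle=c_{ab}N$ on $F$. 4. For two different elements $K,K'$ and any common vertices $a,b$, the vectors $\mathbf t_{ab}$ of $K$ and of $K'$ agree on $K\cap K'$, and there is a constant $c$ with $\langle\mathbf t_{ab},\boldsymbol\theta|_K\rangle=c\,N|_K$ and $\langle\mathbf t_{ab},\boldsymbol\theta|_{K'}\rangle=c\,N|_{K'}$ on $K\cap K'$. So the jump of the tangential components of $\boldsymbol\theta$ is $c$ times the jump of $N$. -/

import Mathlib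

open MeasureTheory Matrix
open scoped ContDiff

noncomputable section

/-- Points and vectors of three-dimensional space, in Cartesian components. The Euclidean inner
product is written with `⬝ᵥ`; square integrability is always required component by component. -/
abbrev R3 : Type := Fin 3 → ℝ

namespace Tet

/-! ### Sobolev spaces -/

/-- The partial derivative of `f` in direction `i`. -/
def pd (i : Fin 3) (f : R3 → ℝ) (x : R3) : ℝ := fderiv ℝ f x (Pi.single i 1)

/-- The classical curl of a vector field. -/
def curl (φ : R3 → R3) (x : R3) : R3 :=
  ![pd 1 (fun y => φ y 2) x - pd 2 (fun y => φ y 1) x,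
    pd 2 (fun y => φ y 0) x - pd 0 (fun y => φ y 2) x,
    pd 0 (fun y => φ y 1) x - pd 1 (fun y => φ y 0) x]

/-- Smooth test functions with compact support in `V`. -/
def IsTest {E : Type*} [NormedAddCommGroup E] [NormedSpace ℝ E] (V : Set R3) (φ : R3 → E) : Prop :=
  ContDiff ℝ ∞ φ ∧ HasCompactSupport φ ∧ tsupport φ ⊆ V

/-- `u ∈ L²(V)`. -/
def L2 (V : Set R3) (u : R3 → ℝ) : Prop := MemLp u 2 (volume.restrict V)

/-- `u ∈ [L²(V)]³`. -/
def L2vec (V : Set R3) (u : R3 → R3) : Prop := ∀ i, L2 V (fun x => u x i)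

theorem L2.integrable_mul {V : Set R3} {u ψ : R3 → ℝ} (hu : L2 V u) (hc : Continuous ψ)
    (hs : HasCompactSupport ψ) : Integrable (fun x => u x * ψ x) (volume.restrict V) :=
  MemLp.integrable_mul (p := 2) (q := 2) hu (hc.memLp_of_hasCompactSupport hs)

theorem continuous_pd {φ : R3 → ℝ} (h : ContDiff ℝ ∞ φ) (i : Fin 3) : Continuous (pd i φ) :=
  (h.continuous_fderiv (by simp)).clm_apply continuous_const

theorem hasCompactSupport_pd {φ : R3 → ℝ} (h : HasCompactSupport φ) (i : Fin 3) :
    HasCompactSupport (pd i φ) :=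
  h.fderiv_apply (𝕜 := ℝ) (Pi.single i 1)

theorem comp_contDiff {φ : R3 → R3} (h : ContDiff ℝ ∞ φ) (i : Fin 3) :
    ContDiff ℝ ∞ (fun x => φ x i) := contDiff_pi.1 h i

theorem comp_hasCompactSupport {φ : R3 → R3} (h : HasCompactSupport φ) (i : Fin 3) :
    HasCompactSupport (fun x => φ x i) :=
  h.comp_left (g := fun v : R3 => v i) rfl

theorem L2vec.integrable_dot {V : Set R3} {u ψ : R3 → R3} (hu : L2vec V u)
    (hc : ∀ i, Continuous fun x => ψ x i) (hs : ∀ i, HasCompactSupport fun x => ψ x i) :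
    Integrable (fun x => u x ⬝ᵥ ψ x) (volume.restrict V) := by
  simp only [dotProduct]
  exact integrable_finsetSum _ fun i _ => L2.integrable_mul (hu i) (hc i) (hs i)

theorem continuous_curl {φ : R3 → R3} (h : ContDiff ℝ ∞ φ) (i : Fin 3) :
    Continuous fun x => curl φ x i := by
  have := fun k j => continuous_pd (comp_contDiff h k) j
  fin_cases i <;> exact (this _ _).sub (this _ _)

theorem hasCompactSupport_curl {φ : R3 → R3} (h : HasCompactSupport φ) (i : Fin 3) :
    HasCompactSupport fun x => curl φ x i := by
  have := fun k j => hasCompactSupport_pd (comp_hasCompactSupport h k) j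
  fin_cases i <;> exact (this _ _).sub (this _ _)

/-- `H¹(V)`: square integrable functions whose weak gradient is square integrable. -/
def H1 (V : Set R3) : Submodule ℝ (R3 → ℝ) where
  carrier := {u | L2 V u ∧ ∃ g : R3 → R3, L2vec V g ∧
    ∀ φ : R3 → ℝ, IsTest V φ → ∀ i, ∫ x in V, u x * pd i φ x = -∫ x in V, g x i * φ x}
  zero_mem' := by
    refine ⟨MemLp.zero, 0, fun i => MemLp.zero, fun φ _ i => by simp⟩
  add_mem' := by
    rintro u v ⟨hu, g, hg, hug⟩ ⟨hv, k, hk, hvk⟩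
    refine ⟨MemLp.add hu hv, g + k, fun i => MemLp.add (hg i) (hk i), fun φ hφ i => ?_⟩
    have h1 := hug φ hφ i
    have h2 := hvk φ hφ i
    have hc := continuous_pd hφ.1 i
    have hs := hasCompactSupport_pd hφ.2.1 i
    simp only [Pi.add_apply, add_mul]
    rw [integral_add (hu.integrable_mul hc hs) (hv.integrable_mul hc hs),
      integral_add ((hg i).integrable_mul hφ.1.continuous hφ.2.1)
        ((hk i).integrable_mul hφ.1.continuous hφ.2.1), h1, h2]
    ring
  smul_mem' := by
    rintro c u ⟨hu, g, hg, hug⟩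
    refine ⟨MemLp.const_smul hu c, c • g, fun i => MemLp.const_smul (hg i) c, fun φ hφ i => ?_⟩
    simp only [Pi.smul_apply, smul_eq_mul, mul_assoc]
    rw [integral_const_mul, integral_const_mul, hug φ hφ i]
    ring

/-- `H(curl, V)`: square integrable fields whose weak curl is square integrable. -/
def HCurl (V : Set R3) : Submodule ℝ (R3 → R3) where
  carrier := {u | L2vec V u ∧ ∃ c : R3 → R3, L2vec V c ∧
    ∀ φ : R3 → R3, IsTest V φ → ∫ x in V, u x ⬝ᵥ curl φ x = ∫ x in V, c x ⬝ᵥ φ x}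
  zero_mem' := by
    refine ⟨fun i => MemLp.zero, 0, fun i => MemLp.zero, fun φ _ => by simp⟩
  add_mem' := by
    rintro u v ⟨hu, g, hg, hug⟩ ⟨hv, k, hk, hvk⟩
    refine ⟨fun i => MemLp.add (hu i) (hv i), g + k, fun i => MemLp.add (hg i) (hk i),
      fun φ hφ => ?_⟩
    have hc := continuous_curl hφ.1
    have hs := hasCompactSupport_curl hφ.2.1
    have hc' := fun i => (comp_contDiff hφ.1 i).continuous
    have hs' := comp_hasCompactSupport hφ.2.1
    simp only [Pi.add_apply, add_dotProduct]
    rw [integral_add (hu.integrable_dot hc hs) (hv.integrable_dot hc hs),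
      integral_add (hg.integrable_dot hc' hs') (hk.integrable_dot hc' hs'), hug φ hφ, hvk φ hφ]
  smul_mem' := by
    rintro c u ⟨hu, g, hg, hug⟩
    refine ⟨fun i => MemLp.const_smul (hu i) c, c • g, fun i => MemLp.const_smul (hg i) c,
      fun φ hφ => ?_⟩
    simp only [Pi.smul_apply, smul_dotProduct, smul_eq_mul]
    rw [integral_const_mul, integral_const_mul, hug φ hφ]

/-! ### The reference tetrahedron -/

/-- The closed unit tetrahedron `Ω`. -/
def refTet : Set R3 := {ξ | (∀ i, ξ i ∈ Set.Icc (0 : ℝ) 1) ∧ ξ 0 + ξ 1 + ξ 2 ≤ 1}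

def e₁ : R3 := ![1, 0, 0]
def e₂ : R3 := ![0, 1, 0]
def e₃ : R3 := ![0, 0, 1]

/-- The vertices `v₁ = 0`, `v₂ = e₃`, `v₃ = e₂`, `v₄ = e₁`, numbered here by `0, 1, 2, 3`. -/
def vertex : Fin 4 → R3 := ![0, e₃, e₂, e₁]

/-- The barycentric coordinates with respect to `vertex`. -/
def bary (ξ : R3) : Fin 4 → ℝ := ![1 - ξ 0 - ξ 1 - ξ 2, ξ 2, ξ 1, ξ 0]

/-- The closed polytope of `Ω` (vertex, edge, face, cell) spanned by the vertices in `s`. -/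
def polytope (s : Finset (Fin 4)) : Set R3 := {ξ ∈ refTet | ∀ a, a ∉ s → bary ξ a = 0}

/-- The number of scalar base functions of degree `p` on a polytope: `1` for a vertex, `p - 1` for
an edge, `(p-2)(p-1)/2` for a face and `(p-3)(p-2)(p-1)/6` for the cell. -/
def polytopeDim (p : ℕ) {α : Type*} (s : Finset α) : ℕ := (p - 1).choose (s.card - 1)

/-- A polynomial basis of degree `p` on `Ω` whose members are associated with the polytopes of `Ω`:
the functions `fn s m`, `m < polytopeDim p s`, belong to the polytope `s`. The field `vanish` is the
polytopal association: the trace of a base function of `s` vanishes on each boundary polytope that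
does not contain `s`. (Values `fn s m` outside the stated range of indices are never used.) -/
structure PolytopalBasis (p : ℕ) where
  fn : Finset (Fin 4) → ℕ → MvPolynomial (Fin 3) ℝ
  totalDegree_le : ∀ s m, s.Nonempty → m < polytopeDim p s → (fn s m).totalDegree ≤ p
  linearIndependent : LinearIndependent ℝ
    (fun i : {i : Finset (Fin 4) × ℕ // i.1.Nonempty ∧ i.2 < polytopeDim p i.1} => fn i.1.1 i.1.2)
  vanish : ∀ s m, s.Nonempty → m < polytopeDim p s → ∀ t : Finset (Fin 4), ¬ s ⊆ t →
    ∀ ξ ∈ polytope t, MvPolynomial.eval ξ (fn s m) = 0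

/-- The polytopal template: the list of template vectors of each polytope. -/
def template (s : Finset (Fin 4)) : List R3 :=
  if s = {0} then [e₃, e₂, e₁]
  else if s = {1} then [e₁ + e₂ + e₃, e₂, e₁]
  else if s = {2} then [e₁ + e₂ + e₃, -e₃, e₁]
  else if s = {3} then [e₁ + e₂ + e₃, -e₃, -e₂]
  else if s = {0, 1} then [e₃, -e₂, -e₁]
  else if s = {0, 2} then [e₂, e₃, -e₁]
  else if s = {0, 3} then [e₁, e₃, e₂]
  else if s = {1, 2} then [e₂, e₁ + e₂ + e₃, -e₁]
  else if s = {1, 3} then [e₁, e₁ + e₂ + e₃, e₂]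
  else if s = {2, 3} then [e₁, e₁ + e₂ + e₃, -e₃]
  else if s = {0, 1, 2} then [e₃, e₂, -e₁]
  else if s = {0, 1, 3} then [e₃, e₁, e₂]
  else if s = {0, 2, 3} then [e₂, e₁, -e₃]
  else if s = {1, 2, 3} then [e₂, e₁, e₁ + e₂ + e₃]
  else if s = {0, 1, 2, 3} then [e₃, e₂, e₁]
  else []

/-- The tangential trace `⟨t, ℓ⟩` of the constant field `ℓ` vanishes on the edge `s`. -/
def EdgeTraceZero (s : Finset (Fin 4)) (ℓ : R3) : Prop :=
  ∀ i ∈ s, ∀ j ∈ s, (vertex j - vertex i) ⬝ᵥ ℓ = 0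

/-- The tangential trace `n × ℓ` of the constant field `ℓ` vanishes on the face `s`; here
`(v_j - v_i) × (v_k - v_i)` is a normal vector of the face with vertices `v_i, v_j, v_k`. -/
def FaceTraceZero (s : Finset (Fin 4)) (ℓ : R3) : Prop :=
  ∀ i ∈ s, ∀ j ∈ s, ∀ k ∈ s,
    ((vertex j - vertex i) ⨯₃ (vertex k - vertex i)) ⨯₃ ℓ = 0

/-- The kinds of vectorial base functions: a scalar base function of the polytope `S` gives
vectorial base functions on the polytope `F`. In this order: vertex-edge, edge, edge-face, face,
face-cell, cell. -/
def IsKind {α : Type*} (S F : Finset α) : Prop :=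
  S ⊆ F ∧ ((S.card = 1 ∧ F.card = 2) ∨ (S.card = 2 ∧ F.card = 2) ∨ (S.card = 2 ∧ F.card = 3) ∨
    (S.card = 3 ∧ F.card = 3) ∨ (S.card = 3 ∧ F.card = 4) ∨ (S.card = 4 ∧ F.card = 4))

/-- The condition that selects, among the template vectors of `s`, those that are used for the
vectorial base functions of kind `(s, f)`. -/
def Admissible (s f : Finset (Fin 4)) (ℓ : R3) : Prop :=
  (f.card = 2 → ¬ EdgeTraceZero f ℓ) ∧
  (f.card = 3 → ¬ FaceTraceZero f ℓ) ∧
  (s.card = 2 → f.card = 3 → EdgeTraceZero s ℓ) ∧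
  (s.card = 3 → f.card = 4 → FaceTraceZero s ℓ)

open Classical in
/-- The template vectors of `s` used for the base functions of kind `(s, f)`, in the order in which
the template lists them. -/
def templateVectors (s f : Finset (Fin 4)) : List R3 :=
  (template s).filter fun ℓ => Admissible s f ℓ

/-! ### Grids and the covariant Piola transformation -/

/-- The Jacobi matrix `J` of a map. -/
def jacobian (f : R3 → R3) (ξ : R3) : Matrix (Fin 3) (Fin 3) ℝ :=
  Matrix.of fun i j => fderiv ℝ f ξ (Pi.single j 1) i

/-- The covariant Piola transformation `J⁻ᵀ ϑ` (as a function of the reference point `ξ`). -/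
def piola (f : R3 → R3) (ϑ : R3 → R3) (ξ : R3) : R3 := ((jacobian f ξ)⁻¹)ᵀ *ᵥ ϑ ξ

/-- The barycentric coordinates of `ξ ∈ Ω`, transported to global vertex numbers by the local to
global vertex numbering `ν`. -/
def globalBary (ν : Fin 4 ↪o ℕ) (ξ : R3) (v : ℕ) : ℝ := ∑ a, if ν a = v then bary ξ a else 0

/-- A conforming grid of (possibly curved) tetrahedra, with element set `ι`. The element `K` is the
image of `Ω` under `map K`, and its local vertices carry the global numbers `node K a`. Local
vertices are numbered by increasing global number, which orients all shared edges and faces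
consistently. By `conforming`, the maps are injective on `Ω`, two different elements intersect
exactly in the polytope spanned by their common vertices, and their maps agree on it. -/
structure Grid (ι : Type*) where
  node : ι → (Fin 4 ↪o ℕ)
  node_injective : Function.Injective fun K => Set.range (node K)
  map : ι → R3 → R3
  contDiff_map : ∀ K, ∃ O : Set R3, IsOpen O ∧ refTet ⊆ O ∧ ContDiffOn ℝ 1 (map K) O
  det_ne_zero : ∀ K, ∀ ξ ∈ refTet, (jacobian (map K) ξ).det ≠ 0
  conforming : ∀ K K', ∀ ξ ∈ refTet, ∀ ξ' ∈ refTet,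
    map K ξ = map K' ξ' ↔ globalBary (node K) ξ = globalBary (node K') ξ'

namespace Grid

variable {ι : Type*} (M : Grid ι)

/-- The global numbers of the vertices of the element `K`. -/
def nodes (K : ι) : Finset ℕ := Finset.univ.map (M.node K).toEmbedding

/-- The polytope of `Ω` that corresponds in the element `K` to the global polytope `S`. -/
def loc (K : ι) (S : Finset ℕ) : Finset (Fin 4) := Finset.univ.filter fun a => M.node K a ∈ S

/-- The function on the grid which on the interior of each element `K` equals
`w K ∘ (map K)⁻¹`; it is zero on the element boundaries, a null set. -/
def glue [Fintype ι] {E : Type*} [AddCommMonoid E] (w : ι → R3 → E) (x : R3) : E :=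
  ∑ K, (M.map K '' interior refTet).indicator
    (fun y => w K (Function.invFunOn (M.map K) refTet y)) x

/-- The restriction to the element `K` of the `m`-th scalar base function of the global polytope
`S`, as a function of the reference point `ξ`. It is zero if `S` is not a polytope of `K`. -/
def localScalar {p : ℕ} (U : PolytopalBasis p) (S : Finset ℕ) (m : ℕ) (K : ι) (ξ : R3) : ℝ :=
  if S ⊆ M.nodes K then MvPolynomial.eval ξ (U.fn (M.loc K S) m) else 0

/-- The restriction to the element `K`, as a function of the reference point `ξ`, of the vectorial
base function of kind `(S, F)` with scalar factor number `m` and template vector number `r`: the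
covariant Piola transform of `n ℓ`. It is zero if `F` is not a polytope of `K`. -/
def localField {p : ℕ} (U : PolytopalBasis p) (S F : Finset ℕ) (m r : ℕ) (K : ι) (ξ : R3) : R3 :=
  if F ⊆ M.nodes K then
    piola (M.map K) (fun η => MvPolynomial.eval η (U.fn (M.loc K S) m) •
      (templateVectors (M.loc K S) (M.loc K F)).getD r 0) ξ
  else 0

/-- `(S, m)` is the index of a scalar base function of the grid. -/
def IsScalarIndex (p : ℕ) (S : Finset ℕ) (m : ℕ) : Prop :=
  S.Nonempty ∧ m < polytopeDim p S ∧ ∃ K, S ⊆ M.nodes K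

/-- `(S, F, m, r)` is the index of a vectorial base function of the grid. -/
def IsBaseIndex (p : ℕ) (S F : Finset ℕ) (m r : ℕ) : Prop :=
  IsKind S F ∧ m < polytopeDim p S ∧
    ∃ K, F ⊆ M.nodes K ∧ r < (templateVectors (M.loc K S) (M.loc K F)).length

/-- The scalar finite element space on the grid given by the basis `U`. -/
def scalarSpace [Fintype ι] {p : ℕ} (U : PolytopalBasis p) : Submodule ℝ (R3 → ℝ) :=
  Submodule.span ℝ {u | ∃ S m, M.IsScalarIndex p S m ∧ u = M.glue (M.localScalar U S m)}

/-- The Nédélec space of the second kind on the grid: the span of the vectorial base functions. -/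
def nedelecSpace [Fintype ι] {p : ℕ} (U : PolytopalBasis p) : Submodule ℝ (R3 → R3) :=
  Submodule.span ℝ
    {u | ∃ S F m r, M.IsBaseIndex p S F m r ∧ u = M.glue (M.localField U S F m r)}

/-- The image `J (v_b - v_a)` at `ξ` of the tangent vector of the reference edge from vertex `a` to
vertex `b`. At points of a face of the element `K` these vectors, for the edges of that face, span
the tangent plane of the face. -/
def tangent (K : ι) (a b : Fin 4) (ξ : R3) : R3 :=
  jacobian (M.map K) ξ *ᵥ (vertex b - vertex a)

end Grid

end Tet

end

/-! The template vectors are signed gradients `± grad i` of the barycentric coordinates, and the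
gradient of the i-th coordinate has zero tangential trace on a polytope exactly when that polytope
omits vertex i. So for each kind `(S, F)` the admissibility condition selects vertices: if F has one
vertex v more than S, only v survives; if F = S, the survivors are the vertices of S except the
smallest, in increasing order. Both the selected vertex and its sign depend only on the order of the
vertices (`getElem?_templateTable`). As local numbering follows global numbering, they are the same
in all elements.

The covariant Piola transform carries reference gradients to physical gradients. Hence every base
field is, on every element, `± N ∇λ_v` with one global vertex v, where λ_v is the hat function
`Grid.hat`. This holds also on elements without F: either v is missing and ∇λ_v = 0, or S is missing
and N = 0.

Conformity: the hat function is continuous across interfaces and smooth inside elements with bounded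
gradient, hence locally Lipschitz in V. For N in H¹ and such a λ, the weak curl of N ∇λ is ∇N × ∇λ,
which is square integrable (`mem_HCurl_of_ae_eq`). For smooth λ this is integration by parts against
φ × ∇λ; the Lipschitz case follows by mollification. No traces or surface integrals are needed.

Traces: J and J⁻ᵀ are dual, so ⟨t_ab, θ⟩ = ± (δ_vb − δ_va) N on the closed element
(`Grid.tangent_dotProduct_localField`). All four trace statements are read off from this formula,
together with the agreement of the tangents on interfaces (`Grid.tangent_eq`). -/

namespace Tet

/-! ### The template in terms of barycentric gradients -/

/-- The gradients of the barycentric coordinates. -/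
def grad : Fin 4 → R3 := ![-(e₁ + e₂ + e₃), e₃, e₂, e₁]

theorem sub_dotProduct_grad (i j k : Fin 4) :
    (vertex j - vertex i) ⬝ᵥ grad k = (if k = j then 1 else 0) - (if k = i then 1 else 0) := by
  fin_cases i <;> fin_cases j <;> fin_cases k <;>
    simp [vertex, grad, e₁, e₂, e₃, dotProduct, Fin.sum_univ_three]

theorem vertex_injective : Function.Injective vertex := by
  intro i j h
  by_contra hij
  have := sub_dotProduct_grad i j i
  simp [h, hij] at this

/-- The k-th barycentric coordinate vanishes on an edge that omits vertex k, and varies along one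
that contains it. -/
theorem edgeTraceZero_iff {s : Finset (Fin 4)} (hs : s.card = 2) {z : ℝ} (hz : z ≠ 0)
    (k : Fin 4) : EdgeTraceZero s (z • grad k) ↔ k ∉ s := by
  simp only [EdgeTraceZero, dotProduct_smul, sub_dotProduct_grad, smul_eq_mul]
  refine ⟨fun h hk => ?_, fun hk i hi j hj => ?_⟩
  · obtain ⟨j, hj, hjk⟩ := Finset.exists_mem_ne (s := s) (by omega) k
    have := h k hk j hj
    simp [hjk.symm, hz] at this
  · rw [if_neg (ne_of_mem_of_not_mem hi hk).symm, if_neg (ne_of_mem_of_not_mem hj hk).symm]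
    simp

theorem cross_cross_eq (x y g : R3) : (x ⨯₃ y) ⨯₃ g = (x ⬝ᵥ g) • y - (y ⬝ᵥ g) • x := by
  ext i
  fin_cases i <;> simp [cross_apply, dotProduct, Fin.sum_univ_three] <;> ring

theorem faceTraceZero_iff {s : Finset (Fin 4)} (hs : s.card = 3) {z : ℝ} (hz : z ≠ 0)
    (k : Fin 4) : FaceTraceZero s (z • grad k) ↔ k ∉ s := by
  simp only [FaceTraceZero, cross_cross_eq, dotProduct_smul, sub_dotProduct_grad, smul_eq_mul]
  refine ⟨fun h hk => ?_, fun hk i hi j hj l hl => ?_⟩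
  -- With i, j the other two vertices, the double cross product reduces to a nonzero multiple of
  -- `vertex j - vertex i`.
  · obtain ⟨i, j, hij, he⟩ := Finset.card_eq_two.1
      (show (s.erase k).card = 2 by rw [Finset.card_erase_of_mem hk, hs])
    have hi : i ∈ s.erase k := by simp [he]
    have hj : j ∈ s.erase k := by simp [he]
    have := h i (Finset.mem_of_mem_erase hi) j (Finset.mem_of_mem_erase hj) k hk
    simp [(Finset.ne_of_mem_erase hi).symm, (Finset.ne_of_mem_erase hj).symm, hz, sub_eq_zero,
      vertex_injective.eq_iff, hij.symm] at this
  · rw [if_neg (ne_of_mem_of_not_mem hi hk).symm, if_neg (ne_of_mem_of_not_mem hj hk).symm,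
      if_neg (ne_of_mem_of_not_mem hl hk).symm]
    simp

/-- The template vectors as signed barycentric gradients. -/
def templateTable (s : Finset (Fin 4)) : List (Fin 4 × ℤ) :=
  if s = {0} then [(1, 1), (2, 1), (3, 1)]
  else if s = {1} then [(0, -1), (2, 1), (3, 1)]
  else if s = {2} then [(0, -1), (1, -1), (3, 1)]
  else if s = {3} then [(0, -1), (1, -1), (2, -1)]
  else if s = {0, 1} then [(1, 1), (2, -1), (3, -1)]
  else if s = {0, 2} then [(2, 1), (1, 1), (3, -1)]
  else if s = {0, 3} then [(3, 1), (1, 1), (2, 1)]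
  else if s = {1, 2} then [(2, 1), (0, -1), (3, -1)]
  else if s = {1, 3} then [(3, 1), (0, -1), (2, 1)]
  else if s = {2, 3} then [(3, 1), (0, -1), (1, -1)]
  else if s = {0, 1, 2} then [(1, 1), (2, 1), (3, -1)]
  else if s = {0, 1, 3} then [(1, 1), (3, 1), (2, 1)]
  else if s = {0, 2, 3} then [(2, 1), (3, 1), (1, -1)]
  else if s = {1, 2, 3} then [(2, 1), (3, 1), (0, -1)]
  else if s = {0, 1, 2, 3} then [(1, 1), (2, 1), (3, 1)]
  else []

theorem template_eq (s : Finset (Fin 4)) :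
    template s = (templateTable s).map fun q => (q.2 : ℝ) • grad q.1 := by
  have h0 : grad 0 = -(e₁ + e₂ + e₃) := rfl
  have h1 : grad 1 = e₃ := rfl
  have h2 : grad 2 = e₂ := rfl
  have h3 : grad 3 = e₁ := rfl
  simp only [template, templateTable, apply_ite (List.map _), List.map_cons, List.map_nil, h0, h1,
    h2, h3, Int.cast_neg, Int.cast_one, neg_smul, one_smul, neg_neg]

theorem templateTable_ne_zero : ∀ s, ∀ q ∈ templateTable s, q.2 ≠ 0 := by decide +kernel

/-- `Admissible` for a nonzero multiple of the gradient of the `k`-th barycentric coordinate. -/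
abbrev AdmissibleIndex (s f : Finset (Fin 4)) (k : Fin 4) : Prop :=
  (f.card = 2 → k ∈ f) ∧ (f.card = 3 → k ∈ f) ∧ (s.card = 2 → f.card = 3 → k ∉ s) ∧
    (s.card = 3 → f.card = 4 → k ∉ s)

theorem admissible_iff (s f : Finset (Fin 4)) {z : ℝ} (hz : z ≠ 0) (k : Fin 4) :
    Admissible s f (z • grad k) ↔ AdmissibleIndex s f k := by
  unfold Admissible AdmissibleIndex
  refine and_congr (imp_congr_right fun h => ?_) (and_congr (imp_congr_right fun h => ?_)
    (and_congr (imp_congr_right fun h => imp_congr_right fun _ => ?_)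
      (imp_congr_right fun h => imp_congr_right fun _ => ?_)))
  · rw [edgeTraceZero_iff h hz, not_not]
  · rw [faceTraceZero_iff h hz, not_not]
  · rw [edgeTraceZero_iff h hz]
  · rw [faceTraceZero_iff h hz]

theorem templateVectors_eq (s f : Finset (Fin 4)) :
    templateVectors s f = ((templateTable s).filter fun q => AdmissibleIndex s f q.1).map
      fun q => (q.2 : ℝ) • grad q.1 := by
  rw [templateVectors, template_eq, List.filter_map]
  congr 1
  refine List.filter_congr fun q hq => ?_
  have : (q.2 : ℝ) ≠ 0 := by exact_mod_cast templateTable_ne_zero s q hq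
  simp [admissible_iff s f this]

instance {α : Type*} [DecidableEq α] (S F : Finset α) : Decidable (IsKind S F) := by
  unfold IsKind; infer_instance

/-- The sign of the gradient that belongs to the vertex `v` in the template of the polytope `S`,
in terms of the order of the vertices. -/
def vertexSign {α : Type*} [LinearOrder α] (S : Finset α) (v : α) : ℤ :=
  if v ∈ S ∨ (S.filter (· < v)).card = max 1 (S.card - 1) then 1 else -1

/-- The `r`-th template vector of kind `(S, F)` is a multiple of the gradient of the barycentric
coordinate of the vertex `v`, in terms of the order of the vertices. -/
def IsTemplateVertex {α : Type*} [LinearOrder α] (S F : Finset α) (r : ℕ) (v : α) : Prop :=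
  F = insert v S ∧ ((v ∈ S ∧ (S.filter (· < v)).card = r + 1) ∨ (v ∉ S ∧ r = 0))

instance {α : Type*} [LinearOrder α] (S F : Finset α) (r : ℕ) (v : α) :
    Decidable (IsTemplateVertex S F r v) := by
  unfold IsTemplateVertex; infer_instance

/-- Sign and template vertex are defined by counting smaller vertices, so order embeddings preserve
them. This transfers the finite checks on `Fin 4` to global vertex numbers. -/
theorem vertexSign_map {α β : Type*} [LinearOrder α] [LinearOrder β] (ν : α ↪o β) (S : Finset α)
    (v : α) : vertexSign (S.map ν.toEmbedding) (ν v) = vertexSign S v := by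
  simp [vertexSign, Finset.filter_map]

theorem isTemplateVertex_map {α β : Type*} [LinearOrder α] [LinearOrder β] (ν : α ↪o β)
    (S F : Finset α) (r : ℕ) (v : α) :
    IsTemplateVertex (S.map ν.toEmbedding) (F.map ν.toEmbedding) r (ν v) ↔
      IsTemplateVertex S F r v := by
  have : insert (ν v) (S.map ν.toEmbedding) = (insert v S).map ν.toEmbedding := by
    simp [Finset.map_insert]
  rw [IsTemplateVertex, this, Finset.map_inj]
  simp [IsTemplateVertex, Finset.filter_map]

theorem isKind_map {α β : Type*} (ν : α ↪ β) (S F : Finset α) :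
    IsKind (S.map ν) (F.map ν) ↔ IsKind S F := by
  simp [IsKind]

theorem exists_isTemplateVertex : ∀ s f : Finset (Fin 4), IsKind s f →
    ∀ r < ((templateTable s).filter fun q => AdmissibleIndex s f q.1).length,
      ∃ i, IsTemplateVertex s f r i := by decide +kernel

/-- The order-theoretic rules reproduce the template. This is a finite check over the polytopes of
one tetrahedron; the bound on r makes it decidable and costs nothing by
`lt_three_of_isTemplateVertex`. -/
theorem getElem?_templateTable : ∀ s f : Finset (Fin 4), IsKind s f → ∀ i, ∀ r < 3,
    IsTemplateVertex s f r i → ((templateTable s).filter fun q => AdmissibleIndex s f q.1)[r]? =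
      some (i, vertexSign s i) := by decide +kernel

theorem vertexSign_edge : ∀ s f : Finset (Fin 4), IsKind s f → ∀ i, ∀ r < 3,
    IsTemplateVertex s f r i → ∀ a b, a < b → f = {a, b} →
      vertexSign s i * ((if i = b then 1 else 0) - (if i = a then 1 else 0)) = 1 := by
  decide +kernel

theorem lt_three_of_isTemplateVertex {s f : Finset (Fin 4)} {r : ℕ} {i : Fin 4}
    (h : IsTemplateVertex s f r i) : r < 3 := by
  obtain ⟨-, ⟨hi, h⟩ | ⟨-, rfl⟩⟩ := h
  · have h1 := Finset.card_lt_card (Finset.filter_ssubset (p := (· < i)).2 ⟨i, hi, lt_irrefl i⟩)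
    have := s.card_le_univ
    simp only [Fintype.card_fin] at this
    omega
  · norm_num

theorem templateVectors_getD {s f : Finset (Fin 4)} (hk : IsKind s f) {r : ℕ} {i : Fin 4}
    (h : IsTemplateVertex s f r i) :
    (templateVectors s f).getD r 0 = (vertexSign s i : ℝ) • grad i := by
  rw [templateVectors_eq, List.getD_eq_getElem?_getD, List.getElem?_map,
    getElem?_templateTable s f hk i r (lt_three_of_isTemplateVertex h) h]
  rfl

theorem vertexSign_eq {α : Type*} [LinearOrder α] (S : Finset α) (v : α) :
    vertexSign S v = 1 ∨ vertexSign S v = -1 := by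
  unfold vertexSign; split_ifs <;> simp

/-! ### Template vertices and tangential components on the grid -/

namespace Grid

variable {ι : Type*} (M : Grid ι)

theorem loc_map (K : ι) {S : Finset ℕ} (h : S ⊆ M.nodes K) :
    (M.loc K S).map (M.node K).toEmbedding = S := by
  ext v
  simp only [loc, Finset.mem_map, Finset.mem_filter, Finset.mem_univ, true_and]
  refine ⟨?_, fun hv => ?_⟩
  · rintro ⟨a, ha, rfl⟩
    exact ha
  · obtain ⟨a, -, rfl⟩ := Finset.mem_map.1 (h hv)
    exact ⟨a, hv, rfl⟩

theorem mem_loc {K : ι} {S : Finset ℕ} {a : Fin 4} : a ∈ M.loc K S ↔ M.node K a ∈ S := by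
  simp [loc]

theorem mem_nodes {K : ι} {v : ℕ} : v ∈ M.nodes K ↔ ∃ a, M.node K a = v := by
  simp [nodes]

theorem isKind_loc {K : ι} {S F : Finset ℕ} (hS : S ⊆ M.nodes K) (hF : F ⊆ M.nodes K) :
    IsKind (M.loc K S) (M.loc K F) ↔ IsKind S F := by
  rw [← isKind_map (M.node K).toEmbedding, M.loc_map K hS, M.loc_map K hF]

theorem isTemplateVertex_loc {K : ι} {S F : Finset ℕ} (hS : S ⊆ M.nodes K) (hF : F ⊆ M.nodes K)
    (r : ℕ) (i : Fin 4) :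
    IsTemplateVertex (M.loc K S) (M.loc K F) r i ↔ IsTemplateVertex S F r (M.node K i) := by
  rw [← isTemplateVertex_map (M.node K), M.loc_map K hS, M.loc_map K hF]

theorem vertexSign_loc {K : ι} {S : Finset ℕ} (hS : S ⊆ M.nodes K) (i : Fin 4) :
    vertexSign (M.loc K S) i = vertexSign S (M.node K i) := by
  rw [← vertexSign_map (M.node K), M.loc_map K hS]

theorem vertexSign_mul_edge {K : ι} {S F : Finset ℕ} (hk : IsKind S F) {r v : ℕ}
    (h : IsTemplateVertex S F r v) {a b : Fin 4} (hab : a < b)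
    (hF : F = {M.node K a, M.node K b}) :
    (vertexSign S v : ℝ) *
      ((if v = M.node K b then 1 else 0) - (if v = M.node K a then 1 else 0)) = 1 := by
  have hFK : F ⊆ M.nodes K := by
    simp [hF, Finset.insert_subset_iff, mem_nodes]
  have hS := hk.1.trans hFK
  obtain ⟨i, rfl⟩ := M.mem_nodes.1 (hFK (h.1 ▸ Finset.mem_insert_self _ _))
  rw [← M.isKind_loc hS hFK] at hk
  rw [← M.isTemplateVertex_loc hS hFK] at h
  have := vertexSign_edge _ _ hk i r (lt_three_of_isTemplateVertex h) h a b hab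
    (by ext c; simp [M.mem_loc, hF])
  rw [M.vertexSign_loc hS] at this
  simp only [EmbeddingLike.apply_eq_iff_eq]
  exact_mod_cast this

variable {M} in
/-- A vectorial base function is a signed product of a scalar base function and the gradient of
the barycentric coordinate of one and the same global vertex, on all elements. -/
theorem IsBaseIndex.exists_isTemplateVertex {p m r : ℕ} {S F : Finset ℕ}
    (h : M.IsBaseIndex p S F m r) : ∃ v, IsTemplateVertex S F r v := by
  obtain ⟨hk, -, K, hF, hr⟩ := h
  rw [templateVectors_eq, List.length_map] at hr
  have hS := hk.1.trans hF
  obtain ⟨i, hi⟩ := Tet.exists_isTemplateVertex _ _ ((M.isKind_loc hS hF).2 hk) r hr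
  exact ⟨M.node K i, (M.isTemplateVertex_loc hS hF r i).1 hi⟩

theorem localField_eq {p m r : ℕ} (U : PolytopalBasis p) {S F : Finset ℕ} (hk : IsKind S F)
    {K : ι} {i : Fin 4} (h : IsTemplateVertex S F r (M.node K i)) (ξ : R3) :
    M.localField U S F m r K ξ =
      (vertexSign S (M.node K i) * M.localScalar U S m K ξ) •
        piola (M.map K) (fun _ => grad i) ξ := by
  -- Since F = S ∪ {v} and v belongs to K, the field and the scalar factor are switched off on the
  -- same elements.
  have hFS : F ⊆ M.nodes K ↔ S ⊆ M.nodes K := by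
    rw [h.1, Finset.insert_subset_iff, and_iff_right (M.mem_nodes.2 ⟨i, rfl⟩)]
  unfold localField localScalar
  simp only [hFS]
  split_ifs with hS
  · have hF := hFS.2 hS
    simp only [piola, templateVectors_getD ((M.isKind_loc hS hF).2 hk)
      ((M.isTemplateVertex_loc hS hF r i).2 h), mulVec_smul, smul_smul]
    rw [M.vertexSign_loc hS, mul_comm]
  · simp

theorem localField_eq_zero {p m r : ℕ} (U : PolytopalBasis p) {S F : Finset ℕ} {K : ι} {v : ℕ}
    (h : IsTemplateVertex S F r v) (hv : v ∉ M.nodes K) (ξ : R3) :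
    M.localField U S F m r K ξ = 0 := by
  rw [localField, if_neg]
  rw [h.1, Finset.insert_subset_iff]
  exact fun h => hv h.1

theorem mulVec_dotProduct_piola {f : R3 → R3} {ξ : R3} (hf : (jacobian f ξ).det ≠ 0) (w ℓ : R3) :
    (jacobian f ξ *ᵥ w) ⬝ᵥ piola f (fun _ => ℓ) ξ = w ⬝ᵥ ℓ := by
  rw [piola, dotProduct_mulVec, vecMul_transpose, mulVec_mulVec,
    nonsing_inv_mul _ (isUnit_iff_ne_zero.2 hf), one_mulVec]

/-- The tangential components of a vectorial base function. -/
theorem tangent_dotProduct_localField {p m r : ℕ} (U : PolytopalBasis p) {S F : Finset ℕ}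
    (hk : IsKind S F) {v : ℕ} (h : IsTemplateVertex S F r v) (K : ι) (a b : Fin 4) {ξ : R3}
    (hξ : ξ ∈ refTet) :
    M.tangent K a b ξ ⬝ᵥ M.localField U S F m r K ξ =
      (vertexSign S v * ((if v = M.node K b then 1 else 0) - (if v = M.node K a then 1 else 0))) *
        M.localScalar U S m K ξ := by
  by_cases hv : v ∈ M.nodes K
  · obtain ⟨i, rfl⟩ := M.mem_nodes.1 hv
    rw [M.localField_eq U hk h, tangent, dotProduct_smul,
      mulVec_dotProduct_piola (M.det_ne_zero K ξ hξ), sub_dotProduct_grad]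
    simp only [EmbeddingLike.apply_eq_iff_eq, smul_eq_mul]
    ring
  · have : ∀ c, v ≠ M.node K c := fun c hc => hv (M.mem_nodes.2 ⟨c, hc.symm⟩)
    simp [M.localField_eq_zero U h hv, this]

end Grid
end Tet

namespace Tet

/-! ### Products of `H¹` functions and gradients of Lipschitz functions -/

open Filter Topology Convolution NNReal ContinuousLinearMap

/-- The gradient of a function. -/
noncomputable def gradient (f : R3 → ℝ) (x : R3) : R3 := fun i => pd i f x

theorem abs_pd_le (f : R3 → ℝ) (i : Fin 3) (x : R3) : |pd i f x| ≤ ‖fderiv ℝ f x‖ := by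
  have := (fderiv ℝ f x).le_opNorm (Pi.single i 1)
  rwa [Pi.norm_single, norm_one, mul_one] at this

theorem measurable_pd (f : R3 → ℝ) (i : Fin 3) : Measurable (pd i f) :=
  measurable_fderiv_apply_const ℝ f _

theorem locallyIntegrable_fderiv {f : R3 → ℝ} {C : ℝ≥0} (hf : LipschitzWith C f) :
    LocallyIntegrable (fderiv ℝ f) := by
  refine (locallyIntegrable_const (C : ℝ)).mono (measurable_fderiv ℝ f).aestronglyMeasurable
    (Eventually.of_forall fun x => ?_)
  simpa using norm_fderiv_le_of_lipschitz ℝ hf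

/-- Differentiation falls on f instead of the kernel: by Rademacher's theorem f is differentiable at
x - t for almost every t, and its Lipschitz constant dominates the difference quotients. -/
theorem hasFDerivAt_mollify {f : R3 → ℝ} {C : ℝ≥0} (hf : LipschitzWith C f)
    (ρ : ContDiffBump (0 : R3)) (x : R3) :
    HasFDerivAt (ρ.normed volume ⋆[lsmul ℝ ℝ, volume] f)
      ((ρ.normed volume ⋆[lsmul ℝ ℝ, volume] fderiv ℝ f) x) x := by
  have hint : Integrable (ρ.normed volume) volume := ρ.integrable_normed
  have hcont : Continuous (ρ.normed (volume : Measure R3)) := ρ.continuous_normed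
  simp only [convolution_def, lsmul_apply]
  have hmeas : ∀ y : R3, Continuous fun t => ρ.normed volume t • f (y - t) := fun y =>
    hcont.smul (hf.continuous.comp (continuous_const.sub continuous_id))
  refine (hasFDerivAt_integral_of_dominated_loc_of_lip (s := Set.univ)
    (bound := fun t => ρ.normed volume t * C)
    (F := fun y t => ρ.normed volume t • f (y - t))
    (F' := fun t => ρ.normed volume t • fderiv ℝ f (x - t)) univ_mem
    (Eventually.of_forall fun y => (hmeas y).aestronglyMeasurable)
    ((hmeas x).integrable_of_hasCompactSupport ρ.hasCompactSupport_normed.smul_right) ?_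
    (Eventually.of_forall fun t => ?_) (hint.mul_const _) ?_).2
  · exact hcont.aestronglyMeasurable.smul
      ((measurable_fderiv ℝ f).comp (measurable_const.sub measurable_id)).aestronglyMeasurable
  · refine LipschitzOnWith.of_dist_le_mul fun y _ z _ => ?_
    have h := hf.dist_le_mul (y - t) (z - t)
    rw [dist_sub_right] at h
    have h0 := ρ.nonneg_normed (μ := volume) t
    rw [dist_smul₀, Real.coe_nnabs, abs_of_nonneg (by positivity), Real.norm_of_nonneg h0,
      mul_assoc]
    gcongr
  · have h := (Measure.measurePreserving_sub_left (volume : Measure R3) x).quasiMeasurePreserving.ae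
      hf.ae_differentiableAt
    filter_upwards [h] with t ht
    have h2 : HasFDerivAt (fun y : R3 => f (y - t)) (fderiv ℝ f (x - t)) x := by
      have := ht.hasFDerivAt.comp x ((hasFDerivAt_id x).sub_const t)
      rwa [ContinuousLinearMap.comp_id] at this
    exact h2.const_smul (ρ.normed volume t)

/-- A sequence of bump functions that shrink to a point. -/
noncomputable def shrinkingBump (n : ℕ) : ContDiffBump (0 : R3) where
  rIn := 1 / (n + 1)
  rOut := 2 * (1 / (n + 1))
  rIn_pos := by positivity
  rIn_lt_rOut := by
    have : (0 : ℝ) < 1 / (n + 1) := by positivity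
    linarith

/-- Smooth approximations of a function. -/
noncomputable def mollify (n : ℕ) (f : R3 → ℝ) : R3 → ℝ :=
  (shrinkingBump n).normed volume ⋆[lsmul ℝ ℝ, volume] f

theorem contDiff_mollify (n : ℕ) {f : R3 → ℝ} (hf : Continuous f) :
    ContDiff ℝ ∞ (mollify n f) :=
  (shrinkingBump n).hasCompactSupport_normed.contDiff_convolution_left _
    (shrinkingBump n).contDiff_normed hf.locallyIntegrable

theorem norm_fderiv_mollify_le (n : ℕ) {f : R3 → ℝ} {C : ℝ≥0} (hf : LipschitzWith C f) (x : R3) :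
    ‖fderiv ℝ (mollify n f) x‖ ≤ C := by
  rw [mollify, (hasFDerivAt_mollify hf _ x).fderiv, convolution_def]
  refine (norm_integral_le_of_norm_le (g := fun t => (shrinkingBump n).normed volume t * C)
    ((shrinkingBump n).integrable_normed.mul_const _) (Eventually.of_forall fun t => ?_)).trans ?_
  · have h0 := (shrinkingBump n).nonneg_normed (μ := volume) t
    rw [lsmul_apply, norm_smul, Real.norm_of_nonneg h0]
    gcongr
    exact norm_fderiv_le_of_lipschitz ℝ hf
  · rw [integral_mul_const, (shrinkingBump n).integral_normed, one_mul]

theorem tendsto_fderiv_mollify {f : R3 → ℝ} {C : ℝ≥0} (hf : LipschitzWith C f) :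
    ∀ᵐ x, Tendsto (fun n => fderiv ℝ (mollify n f) x) atTop (𝓝 (fderiv ℝ f x)) := by
  have h1 : Tendsto (fun n => (shrinkingBump n).rOut) atTop (𝓝 0) := by
    simpa [shrinkingBump] using
      (tendsto_one_div_add_atTop_nhds_zero_nat (𝕜 := ℝ)).const_mul 2
  -- Lebesgue differentiation applied to the derivative of f; it needs a bounded ratio of outer to
  -- inner radius, here 2.
  filter_upwards [ContDiffBump.ae_convolution_tendsto_right_of_locallyIntegrable (K := 2) h1
    (Eventually.of_forall fun n => le_rfl) (locallyIntegrable_fderiv hf)] with x hx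
  exact hx.congr fun n => (hasFDerivAt_mollify hf _ x).fderiv.symm

theorem tendsto_integral_gradient_mollify {V : Set R3} {f : R3 → ℝ} {C : ℝ≥0}
    (hf : LipschitzWith C f) {w : R3 → R3} (hw : ∀ i, IntegrableOn (fun x => w x i) V) :
    Tendsto (fun n => ∫ x in V, gradient (mollify n f) x ⬝ᵥ w x) atTop
      (𝓝 (∫ x in V, gradient f x ⬝ᵥ w x)) := by
  refine tendsto_integral_of_dominated_convergence (fun x => ∑ i, C * |w x i|) (fun n => ?_)
    (integrable_finsetSum _ fun i _ => (hw i).abs.const_mul _) (fun n => ?_) ?_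
  · simp only [dotProduct]
    exact Finset.aestronglyMeasurable_fun_sum _ fun i _ =>
      (measurable_pd _ i).aestronglyMeasurable.mul (hw i).aestronglyMeasurable
  · refine Eventually.of_forall fun x => (Finset.abs_sum_le_sum_abs _ _).trans
      (Finset.sum_le_sum fun i _ => ?_)
    rw [abs_mul]
    gcongr
    exact (abs_pd_le _ i x).trans (norm_fderiv_mollify_le n hf x)
  · filter_upwards [ae_restrict_of_ae (tendsto_fderiv_mollify hf)] with x hx
    exact tendsto_finsetSum _ fun i _ =>
      ((ContinuousLinearMap.apply ℝ ℝ (Pi.single i 1 : R3)).continuous.tendsto _ |>.comp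
        hx).mul_const _

theorem contDiff_pd {f : R3 → ℝ} (h : ContDiff ℝ ∞ f) (i : Fin 3) : ContDiff ℝ ∞ (pd i f) :=
  (h.fderiv_right (m := ∞) (by simp)).clm_apply contDiff_const

theorem pd_comm {f : R3 → ℝ} (h : ContDiff ℝ ∞ f) (i j : Fin 3) (x : R3) :
    pd i (pd j f) x = pd j (pd i f) x := by
  have hd : DifferentiableAt ℝ (fderiv ℝ f) x :=
    ((h.fderiv_right (m := ∞) (by simp)).differentiable (by simp)) x
  have key : ∀ i j : Fin 3, pd i (pd j f) x =
      fderiv ℝ (fderiv ℝ f) x (Pi.single i 1) (Pi.single j 1) := fun i j => by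
    have : HasFDerivAt (pd j f) _ x := hd.hasFDerivAt.clm_apply (hasFDerivAt_const _ x)
    rw [pd, this.fderiv]
    simp
  rw [key, key]
  exact (h.contDiffAt.isSymmSndFDerivAt
    (by simpa using WithTop.coe_le_coe.2 (le_top : (2 : ℕ∞) ≤ ⊤))).eq _ _

theorem pd_mul {a b : R3 → ℝ} (ha : ContDiff ℝ ∞ a) (hb : ContDiff ℝ ∞ b) (i : Fin 3) (x : R3) :
    pd i (fun y => a y * b y) x = a x * pd i b x + b x * pd i a x := by
  rw [pd, fderiv_fun_mul (ha.differentiable (by simp) x) (hb.differentiable (by simp) x)]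
  rfl

theorem pd_sub {a b : R3 → ℝ} (ha : ContDiff ℝ ∞ a) (hb : ContDiff ℝ ∞ b) (i : Fin 3) (x : R3) :
    pd i (fun y => a y - b y) x = pd i a x - pd i b x := by
  rw [pd, fderiv_fun_sub (ha.differentiable (by simp) x) (hb.differentiable (by simp) x)]
  rfl

/-- The weak gradient `g` of a function `u` on `V`. -/
noncomputable def IsWeakGradient (V : Set R3) (u : R3 → ℝ) (g : R3 → R3) : Prop :=
  ∀ φ : R3 → ℝ, IsTest V φ → ∀ i, ∫ x in V, u x * pd i φ x = -∫ x in V, g x i * φ x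

/-- The divergence of `φ × ∇f`. -/
theorem sum_pd_cross_gradient {f : R3 → ℝ} (hf : ContDiff ℝ ∞ f) {φ : R3 → R3}
    (hφ : ContDiff ℝ ∞ φ) (x : R3) :
    ∑ i, pd i (fun y => (φ y ⨯₃ gradient f y) i) x = gradient f x ⬝ᵥ curl φ x := by
  have h1 := fun i j => (comp_contDiff hφ i).mul (contDiff_pd hf j)
  have h2 := fun i j k => pd_mul (comp_contDiff hφ i) (contDiff_pd hf j) k x
  simp only [cross_apply, Fin.sum_univ_three, gradient, curl, dotProduct, cons_val_zero,
    cons_val_one, cons_val]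
  rw [pd_sub (h1 _ _) (h1 _ _), pd_sub (h1 _ _) (h1 _ _), pd_sub (h1 _ _) (h1 _ _)]
  simp only [h2]
  -- The second derivatives of f cancel by symmetry: the curl of a gradient vanishes.
  rw [pd_comm hf 1 0, pd_comm hf 2 0, pd_comm hf 2 1]
  ring

theorem isTest_cross_gradient {V : Set R3} {f : R3 → ℝ} (hf : ContDiff ℝ ∞ f) {φ : R3 → R3}
    (hφ : IsTest V φ) (i : Fin 3) : IsTest V fun y => (φ y ⨯₃ gradient f y) i := by
  have hsupp : (Function.support fun y => (φ y ⨯₃ gradient f y) i) ⊆ Function.support φ := by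
    intro y hy h
    simp [h] at hy
  refine ⟨?_, hφ.2.1.mono hsupp, (closure_mono hsupp).trans hφ.2.2⟩
  have h1 := fun i j => (comp_contDiff hφ.1 i).mul (contDiff_pd hf j)
  fin_cases i <;> exact (h1 _ _).sub (h1 _ _)

theorem L2vec.integrable_cross {V : Set R3} {g φ : R3 → R3} (hg : L2vec V g)
    (hφ : IsTest V φ) (i : Fin 3) : IntegrableOn (fun x => (φ x ⨯₃ g x) i) V := by
  have h (i j : Fin 3) : IntegrableOn (fun x => φ x i * g x j) V := by
    simp only [mul_comm (φ _ i)]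
    exact (hg j).integrable_mul (comp_contDiff hφ.1 i).continuous
      (comp_hasCompactSupport hφ.2.1 i)
  fin_cases i <;> exact (h _ _).sub (h _ _)

/-- For smooth f, ∇f · curl φ is the divergence of φ × ∇f, whose components are admissible test
functions for the weak gradient of u. A cyclic permutation of the triple product finishes. -/
theorem integral_gradient_curl_of_contDiff {V : Set R3} {u : R3 → ℝ} {g : R3 → R3} (hu : L2 V u)
    (hg : L2vec V g) (hw : IsWeakGradient V u g) {f : R3 → ℝ} (hf : ContDiff ℝ ∞ f)
    {φ : R3 → R3} (hφ : IsTest V φ) :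
    ∫ x in V, gradient f x ⬝ᵥ (u x • curl φ x) = ∫ x in V, gradient f x ⬝ᵥ (φ x ⨯₃ g x) := by
  have ht := isTest_cross_gradient hf hφ
  calc ∫ x in V, gradient f x ⬝ᵥ (u x • curl φ x)
      = ∫ x in V, ∑ i, u x * pd i (fun y => (φ y ⨯₃ gradient f y) i) x := by
        refine integral_congr_ae (Eventually.of_forall fun x => ?_)
        simp only [dotProduct_smul, smul_eq_mul, ← Finset.mul_sum, sum_pd_cross_gradient hf hφ.1]
    _ = ∑ i, -∫ x in V, g x i * (φ x ⨯₃ gradient f x) i := by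
        rw [integral_finsetSum _ fun i _ =>
          hu.integrable_mul (continuous_pd (ht i).1 i) (hasCompactSupport_pd (ht i).2.1 i)]
        exact Finset.sum_congr rfl fun i _ => hw _ (ht i) i
    _ = ∫ x in V, gradient f x ⬝ᵥ (φ x ⨯₃ g x) := by
        rw [Finset.sum_neg_distrib, ← integral_finsetSum _ fun i _ =>
          (hg i).integrable_mul (ht i).1.continuous (ht i).2.1, ← integral_neg]
        refine integral_congr_ae (Eventually.of_forall fun x => ?_)
        simp only [dotProduct, Fin.sum_univ_three, cross_apply, cons_val_zero, cons_val_one,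
          cons_val]
        ring

theorem integral_gradient_curl {V : Set R3} {u : R3 → ℝ} {g : R3 → R3} (hu : L2 V u)
    (hg : L2vec V g) (hw : IsWeakGradient V u g) {f : R3 → ℝ} {C : ℝ≥0} (hf : LipschitzWith C f)
    {φ : R3 → R3} (hφ : IsTest V φ) :
    ∫ x in V, gradient f x ⬝ᵥ (u x • curl φ x) = ∫ x in V, gradient f x ⬝ᵥ (φ x ⨯₃ g x) := by
  refine tendsto_nhds_unique (tendsto_integral_gradient_mollify hf fun i => ?_)
    ((tendsto_integral_gradient_mollify hf fun i => hg.integrable_cross hφ i).congr fun n =>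
      (integral_gradient_curl_of_contDiff hu hg hw (contDiff_mollify n hf.continuous) hφ).symm)
  exact hu.integrable_mul (continuous_curl hφ.1 i) (hasCompactSupport_curl hφ.2.1 i)

theorem L2.mul_pd {V : Set R3} (hV : IsOpen V) {u Λ : R3 → ℝ} (hu : L2 V u) {L : ℝ}
    (hb : ∀ x ∈ V, ‖fderiv ℝ Λ x‖ ≤ L) (i : Fin 3) : L2 V fun x => u x * pd i Λ x := by
  refine MemLp.of_le_mul (c := L) hu
    (hu.aestronglyMeasurable.mul (measurable_pd Λ i).aestronglyMeasurable) ?_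
  filter_upwards [ae_restrict_mem hV.measurableSet] with x hx
  rw [norm_mul, mul_comm]
  gcongr
  exact (abs_pd_le Λ i x).trans (hb x hx)

/-- The product of an `H¹` function and the gradient of a locally Lipschitz function with bounded
gradient is in `H(curl)`. -/
theorem mem_HCurl_of_ae_eq {V : Set R3} (hV : IsOpen V) {u Λ : R3 → ℝ} (hu : u ∈ H1 V)
    (hΛ : LocallyLipschitzOn V Λ) {L : ℝ} (hb : ∀ x ∈ V, ‖fderiv ℝ Λ x‖ ≤ L) {w : R3 → R3}
    (hw : ∀ᵐ x ∂volume.restrict V, w x = u x • gradient Λ x) : w ∈ HCurl V := by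
  obtain ⟨hu2, g, hg, hug⟩ := hu
  -- The weak curl is ∇u × ∇Λ, as the curl of ∇Λ contributes nothing.
  refine ⟨fun i => (hu2.mul_pd hV hb i).ae_eq ?_, fun x => g x ⨯₃ gradient Λ x, fun i => ?_,
    fun φ hφ => ?_⟩
  · filter_upwards [hw] with x hx
    simp [hx, gradient]
  · have h := fun i j => (hg i).mul_pd hV hb j
    fin_cases i <;> exact (h _ _).sub (h _ _)
  -- Mollification needs a globally Lipschitz function: Λ is restricted to a compact neighbourhood
  -- of the support of φ and then extended. The gradients still agree on the support, which lies in
  -- the interior of k.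
  · obtain ⟨k, hk, hφk, hkV⟩ := exists_compact_between hφ.2.1 hV hφ.2.2
    obtain ⟨C, hC⟩ := (hΛ.mono hkV).exists_lipschitzOnWith_of_compact hk
    obtain ⟨f, hf, hfΛ⟩ := hC.extend_real
    have hgrad : ∀ x ∈ tsupport φ, gradient Λ x = gradient f x := fun x hx => by
      have : Λ =ᶠ[𝓝 x] f := by
        filter_upwards [isOpen_interior.mem_nhds (hφk hx)] with y hy
        exact hfΛ (interior_subset hy)
      funext i
      rw [gradient, gradient, pd, pd, this.fderiv_eq]
    have hzero : ∀ x ∉ tsupport φ, φ x = 0 ∧ curl φ x = 0 := fun x hx => by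
      have h0 : φ =ᶠ[𝓝 x] 0 := notMem_tsupport_iff_eventuallyEq.1 hx
      refine ⟨h0.eq_of_nhds, ?_⟩
      have : ∀ i j, pd i (fun y => φ y j) x = 0 := fun i j => by
        have : (fun y => φ y j) =ᶠ[𝓝 x] fun _ => 0 := by
          filter_upwards [h0] with y hy
          simp [hy]
        rw [pd, this.fderiv_eq]
        simp
      ext i
      fin_cases i <;> simp [curl, this]
    calc ∫ x in V, w x ⬝ᵥ curl φ x
        = ∫ x in V, gradient f x ⬝ᵥ (u x • curl φ x) := by
          refine integral_congr_ae ?_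
          filter_upwards [hw] with x hx
          rw [hx]
          by_cases hxs : x ∈ tsupport φ
          · rw [hgrad x hxs, smul_dotProduct, dotProduct_smul]
          · simp [(hzero x hxs).2]
      _ = ∫ x in V, gradient f x ⬝ᵥ (φ x ⨯₃ g x) := integral_gradient_curl hu2 hg hug hf hφ
      _ = ∫ x in V, (g x ⨯₃ gradient Λ x) ⬝ᵥ φ x := by
          refine integral_congr_ae (Eventually.of_forall fun x => ?_)
          by_cases hxs : x ∈ tsupport φ
          · simp only [hgrad x hxs, dotProduct, Fin.sum_univ_three, cross_apply, cons_val_zero,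
              cons_val_one, cons_val]
            ring
          · simp [(hzero x hxs).1]

end Tet

namespace Tet

/-! ### Barycentric coordinates -/

open Filter Topology

theorem bary_eq (ξ : R3) (a : Fin 4) : bary ξ a = bary 0 a + grad a ⬝ᵥ ξ := by
  fin_cases a <;> simp [bary, grad, e₁, e₂, e₃, dotProduct, Fin.sum_univ_three]
  ring

theorem continuous_bary (a : Fin 4) : Continuous fun ξ => bary ξ a := by
  rw [funext fun ξ => bary_eq ξ a]
  fun_prop

theorem sum_bary (ξ : R3) : ∑ a, bary ξ a = 1 := by
  simp [bary, Fin.sum_univ_four]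

theorem bary_injective : Function.Injective bary := by
  intro ξ η h
  have h1 := congrFun h 1
  have h2 := congrFun h 2
  have h3 := congrFun h 3
  simp only [bary, cons_val] at h1 h2 h3
  ext i
  fin_cases i <;> assumption

theorem bary_add_smul (ξ : R3) (t : ℝ) (a b c : Fin 4) :
    bary (ξ + t • (vertex b - vertex a)) c =
      bary ξ c + t * ((if c = b then 1 else 0) - (if c = a then 1 else 0)) := by
  rw [bary_eq _ c, bary_eq ξ c, dotProduct_add, dotProduct_smul, dotProduct_comm (grad c) (_ - _),
    sub_dotProduct_grad, smul_eq_mul]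
  ring

theorem mem_refTet_iff {ξ : R3} : ξ ∈ refTet ↔ ∀ a, 0 ≤ bary ξ a := by
  simp [refTet, bary, Fin.forall_fin_succ]
  constructor
  · rintro ⟨⟨⟨h0, -⟩, ⟨h1, -⟩, ⟨h2, -⟩⟩, h⟩
    exact ⟨by linarith, h2, h1, h0⟩
  · rintro ⟨h, h2, h1, h0⟩
    exact ⟨⟨⟨h0, by linarith⟩, ⟨h1, by linarith⟩, ⟨h2, by linarith⟩⟩, by linarith⟩

theorem isClosed_refTet : IsClosed refTet := by
  have : refTet = ⋂ a, {ξ | 0 ≤ bary ξ a} := by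
    ext ξ
    simp [mem_refTet_iff]
  rw [this]
  exact isClosed_iInter fun a => isClosed_le continuous_const (continuous_bary a)

theorem isCompact_refTet : IsCompact refTet :=
  (isCompact_Icc (a := (0 : R3)) (b := 1)).of_isClosed_subset isClosed_refTet fun _ hξ =>
    ⟨fun i => (hξ.1 i).1, fun i => (hξ.1 i).2⟩

theorem convex_refTet : Convex ℝ refTet := by
  intro ξ hξ η hη s t hs ht hst
  rw [mem_refTet_iff] at *
  intro a
  have : bary (s • ξ + t • η) a = s * bary ξ a + t * bary η a := by
    rw [bary_eq, bary_eq ξ, bary_eq η, dotProduct_add, dotProduct_smul, dotProduct_smul,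
      smul_eq_mul, smul_eq_mul]
    linear_combination -bary 0 a * hst
  rw [this]
  exact add_nonneg (mul_nonneg hs (hξ a)) (mul_nonneg ht (hη a))

theorem bary_pos_of_mem_interior {ξ : R3} (hξ : ξ ∈ interior refTet) (a : Fin 4) :
    0 < bary ξ a := by
  obtain ⟨b, hb⟩ := exists_ne a
  have hc : Tendsto (fun t : ℝ => ξ + t • (vertex b - vertex a)) (𝓝 0) (𝓝 ξ) := by
    have : Continuous fun t : ℝ => ξ + t • (vertex b - vertex a) := by fun_prop
    simpa using this.tendsto 0
  have h : ∀ᶠ t in 𝓝[>] (0 : ℝ), ξ + t • (vertex b - vertex a) ∈ refTet :=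
    nhdsWithin_le_nhds (hc (mem_interior_iff_mem_nhds.1 hξ))
  obtain ⟨t, ht, ht0⟩ := (h.and self_mem_nhdsWithin).exists
  have := mem_refTet_iff.1 ht a
  rw [bary_add_smul, if_neg hb.symm, if_pos rfl] at this
  have : 0 < t := ht0
  linarith

theorem add_smul_mem_refTet {ξ : R3} (hξ : ξ ∈ refTet) {t : ℝ} {a b : Fin 4}
    (ht : t ∈ Set.Icc 0 (bary ξ a)) : ξ + t • (vertex b - vertex a) ∈ refTet := by
  rw [mem_refTet_iff] at *
  intro c
  rw [bary_add_smul]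
  have := hξ c
  have h0 := ht.1
  have h1 := ht.2
  split_ifs with h2 h3 h3
  · linarith
  · linarith
  · subst h3; linarith
  · linarith

/-! ### Global barycentric coordinates -/

theorem globalBary_apply (ν : Fin 4 ↪o ℕ) (ξ : R3) (a : Fin 4) :
    globalBary ν ξ (ν a) = bary ξ a := by
  simp [globalBary]

theorem globalBary_eq_zero {ν : Fin 4 ↪o ℕ} {v : ℕ} (hv : ∀ a, ν a ≠ v) (ξ : R3) :
    globalBary ν ξ v = 0 := by
  simp [globalBary, hv]

theorem globalBary_add_smul (ν : Fin 4 ↪o ℕ) (ξ : R3) (t : ℝ) (a b : Fin 4) (v : ℕ) :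
    globalBary ν (ξ + t • (vertex b - vertex a)) v =
      globalBary ν ξ v + t * ((if v = ν b then 1 else 0) - (if v = ν a then 1 else 0)) := by
  by_cases hv : ∃ c, ν c = v
  · obtain ⟨c, rfl⟩ := hv
    simp [globalBary_apply, bary_add_smul]
  · push Not at hv
    simp [globalBary_eq_zero hv, (hv _).symm]

/-- The gradient of `globalBary ν · v`. -/
noncomputable def globalGrad (ν : Fin 4 ↪o ℕ) (v : ℕ) : R3 := ∑ a, if ν a = v then grad a else 0

theorem globalGrad_apply (ν : Fin 4 ↪o ℕ) (a : Fin 4) : globalGrad ν (ν a) = grad a := by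
  simp [globalGrad]

theorem globalGrad_eq_zero {ν : Fin 4 ↪o ℕ} {v : ℕ} (hv : ∀ a, ν a ≠ v) :
    globalGrad ν v = 0 := by
  simp [globalGrad, hv]

theorem globalBary_eq (ν : Fin 4 ↪o ℕ) (ξ : R3) (v : ℕ) :
    globalBary ν ξ v = globalBary ν 0 v + globalGrad ν v ⬝ᵥ ξ := by
  by_cases hv : ∃ c, ν c = v
  · obtain ⟨c, rfl⟩ := hv
    rw [globalBary_apply, globalBary_apply, globalGrad_apply, bary_eq]
  · push Not at hv
    simp [globalBary_eq_zero hv, globalGrad_eq_zero hv]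

/-- The linear functional `globalGrad ν v ⬝ᵥ ·`. -/
noncomputable def globalGradL (ν : Fin 4 ↪o ℕ) (v : ℕ) : R3 →L[ℝ] ℝ :=
  LinearMap.toContinuousLinearMap (dotProductBilin ℝ ℝ (globalGrad ν v))

theorem globalGradL_apply (ν : Fin 4 ↪o ℕ) (v : ℕ) (w : R3) :
    globalGradL ν v w = globalGrad ν v ⬝ᵥ w := rfl

theorem hasFDerivAt_globalBary (ν : Fin 4 ↪o ℕ) (v : ℕ) (ξ : R3) :
    HasFDerivAt (fun η => globalBary ν η v) (globalGradL ν v) ξ := by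
  rw [funext fun η => globalBary_eq ν η v]
  exact (globalGradL ν v).hasFDerivAt.const_add _

theorem jacobian_mulVec (f : R3 → R3) (ξ w : R3) : jacobian f ξ *ᵥ w = fderiv ℝ f ξ w := by
  have : jacobian f ξ = LinearMap.toMatrix' (fderiv ℝ f ξ : R3 →ₗ[ℝ] R3) := by
    ext i j
    simp [jacobian, LinearMap.toMatrix'_apply]
  rw [this, LinearMap.toMatrix'_mulVec]
  rfl

/-! ### Element maps and their inverses -/

namespace Grid

variable {ι : Type*} (M : Grid ι)

theorem hasStrictFDerivAt (K : ι) {ξ : R3} (hξ : ξ ∈ refTet) :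
    HasStrictFDerivAt (M.map K) (fderiv ℝ (M.map K) ξ) ξ := by
  obtain ⟨O, hO, hsub, hc⟩ := M.contDiff_map K
  exact (hc.contDiffAt (hO.mem_nhds (hsub hξ))).hasStrictFDerivAt (by simp)

theorem exists_continuousLinearEquiv (K : ι) {ξ : R3} (hξ : ξ ∈ refTet) :
    ∃ A : R3 ≃L[ℝ] R3, (A : R3 →L[ℝ] R3) = fderiv ℝ (M.map K) ξ := by
  have hinj : Function.Injective (fderiv ℝ (M.map K) ξ) := by
    refine (injective_iff_map_eq_zero _).2 fun w hw => ?_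
    rw [← jacobian_mulVec] at hw
    exact eq_zero_of_mulVec_eq_zero (M.det_ne_zero K ξ hξ) hw
  exact ⟨(LinearEquiv.ofInjectiveEndo (fderiv ℝ (M.map K) ξ : R3 →ₗ[ℝ] R3)
    hinj).toContinuousLinearEquiv, by ext; rfl⟩

theorem injOn (K : ι) : Set.InjOn (M.map K) refTet := by
  intro ξ hξ η hη h
  have := (M.conforming K K ξ hξ η hη).1 h
  refine bary_injective (funext fun a => ?_)
  rw [← globalBary_apply (M.node K), this, globalBary_apply]

theorem continuousOn_map (K : ι) : ContinuousOn (M.map K) refTet := fun _ hξ =>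
  (M.hasStrictFDerivAt K hξ).continuousAt.continuousWithinAt

/-- The inverse of an element map is Lipschitz. -/
theorem exists_norm_sub_le (K : ι) : ∃ C : ℝ, ∀ ξ ∈ refTet, ∀ η ∈ refTet,
    ‖ξ - η‖ ≤ C * ‖M.map K ξ - M.map K η‖ := by
  suffices ∃ C : ℝ, ∀ q ∈ refTet ×ˢ refTet, ‖q.1 - q.2‖ ≤ C * ‖M.map K q.1 - M.map K q.2‖ by
    obtain ⟨C, hC⟩ := this
    exact ⟨C, fun ξ hξ η hη => hC (ξ, η) ⟨hξ, hη⟩⟩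
  -- By compactness the estimate is only needed near each pair of points: on the diagonal it follows
  -- from the invertible strict derivative, off the diagonal from injectivity.
  refine (isCompact_refTet.prod isCompact_refTet).induction_on
    (p := fun s => ∃ C : ℝ, ∀ q ∈ s, ‖q.1 - q.2‖ ≤ C * ‖M.map K q.1 - M.map K q.2‖)
    ⟨0, by simp⟩ ?_ ?_ ?_
  · rintro s t hst ⟨C, hC⟩
    exact ⟨C, fun q hq => hC q (hst hq)⟩
  · rintro s t ⟨C, hC⟩ ⟨D, hD⟩
    refine ⟨max C D, fun q hq => hq.elim (fun h => (hC q h).trans ?_) fun h => (hD q h).trans ?_⟩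
    · gcongr
      exact le_max_left _ _
    · gcongr
      exact le_max_right _ _
  · rintro ⟨ξ, η⟩ ⟨hξ, hη⟩
    suffices (fun q : R3 × R3 => q.1 - q.2) =O[𝓝[refTet ×ˢ refTet] (ξ, η)]
        fun q => M.map K q.1 - M.map K q.2 by
      obtain ⟨C, hC⟩ := this.bound
      exact ⟨_, hC, C, fun q hq => hq⟩
    by_cases h : ξ = η
    · subst h
      obtain ⟨A, hA⟩ := M.exists_continuousLinearEquiv K hξ
      have := (M.hasStrictFDerivAt K hξ).isTheta_sub
        (by rw [← hA]; exact A.toHomeomorph.isInducing)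
      exact this.isBigO_symm.mono nhdsWithin_le_nhds
    · have h1 : Tendsto (fun q : R3 × R3 => M.map K q.1 - M.map K q.2)
          (𝓝[refTet ×ˢ refTet] (ξ, η)) (𝓝 (M.map K ξ - M.map K η)) :=
        (((M.hasStrictFDerivAt K hξ).continuousAt.tendsto.comp continuous_fst.continuousAt).sub
          ((M.hasStrictFDerivAt K hη).continuousAt.tendsto.comp
            continuous_snd.continuousAt)).mono_left nhdsWithin_le_nhds
      have h2 : Tendsto (fun q : R3 × R3 => q.1 - q.2)
          (𝓝[refTet ×ˢ refTet] (ξ, η)) (𝓝 (ξ - η)) :=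
        (continuous_fst.sub continuous_snd).continuousAt.tendsto.mono_left nhdsWithin_le_nhds
      exact (h2.isBigO_one ℝ).trans (((Asymptotics.isBigO_const_left_iff_pos_le_norm
        one_ne_zero).2 (by
          have hpos : 0 < ‖M.map K ξ - M.map K η‖ :=
            norm_pos_iff.2 (sub_ne_zero.2 fun he => h (M.injOn K hξ hη he))
          exact ⟨_, half_pos hpos, (h1.norm.eventually_const_lt (half_lt_self hpos)).mono
            fun q hq => hq.le⟩)))

/-! ### The tangents on the interface of two elements -/

theorem hasDerivWithinAt_map (K : ι) {ξ : R3} (hξ : ξ ∈ refTet) (a b : Fin 4) (s : Set ℝ) :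
    HasDerivWithinAt (fun t : ℝ => M.map K (ξ + t • (vertex b - vertex a)))
      (M.tangent K a b ξ) s 0 := by
  have h1 : HasDerivAt (fun t : ℝ => ξ + t • (vertex b - vertex a)) (vertex b - vertex a) 0 := by
    simpa using ((hasDerivAt_id (0 : ℝ)).smul_const (vertex b - vertex a)).const_add ξ
  have h2 : HasFDerivAt (M.map K) (fderiv ℝ (M.map K) ξ)
      (ξ + (0 : ℝ) • (vertex b - vertex a)) := by
    simpa using (M.hasStrictFDerivAt K hξ).hasFDerivAt
  rw [tangent, jacobian_mulVec]
  exact (h2.comp_hasDerivAt 0 h1).hasDerivWithinAt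

/-- When the a-th coordinate is positive, a short segment from ξ towards b - a stays in Ω. The two
maps agree on corresponding segments, so their one-sided derivatives at the start coincide. -/
theorem tangent_eq_of_bary_pos {K K' : ι} {ξ ξ' : R3} (hξ : ξ ∈ refTet) (hξ' : ξ' ∈ refTet)
    (h : M.map K ξ = M.map K' ξ') {a a' b b' : Fin 4} (ha : M.node K a = M.node K' a')
    (hb : M.node K b = M.node K' b') (hpos : 0 < bary ξ a) :
    M.tangent K a b ξ = M.tangent K' a' b' ξ' := by
  have hg := (M.conforming K K' ξ hξ ξ' hξ').1 h
  have hbary : bary ξ a = bary ξ' a' := by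
    rw [← globalBary_apply (M.node K), hg, ha, globalBary_apply]
  have heq : ∀ t ∈ Set.Icc 0 (bary ξ a), M.map K (ξ + t • (vertex b - vertex a)) =
      M.map K' (ξ' + t • (vertex b' - vertex a')) := fun t ht => by
    refine (M.conforming K K' _ (add_smul_mem_refTet hξ ht) _
      (add_smul_mem_refTet hξ' (hbary ▸ ht))).2 (funext fun v => ?_)
    rw [globalBary_add_smul, globalBary_add_smul, hg, ha, hb]
  have h0 : (0 : ℝ) ∈ Set.Icc 0 (bary ξ a) := ⟨le_rfl, hpos.le⟩
  exact (uniqueDiffOn_Icc hpos 0 h0).eq_deriv _ (M.hasDerivWithinAt_map K hξ a b _)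
    ((M.hasDerivWithinAt_map K' hξ' a' b' _).congr heq (heq 0 h0))

theorem tangent_eq {K K' : ι} {ξ ξ' : R3} (hξ : ξ ∈ refTet) (hξ' : ξ' ∈ refTet)
    (h : M.map K ξ = M.map K' ξ') {a a' b b' : Fin 4} (ha : M.node K a = M.node K' a')
    (hb : M.node K b = M.node K' b') : M.tangent K a b ξ = M.tangent K' a' b' ξ' := by
  -- If the coordinate of a vanishes, the detour t_ab = t_cb − t_ca uses a vertex c with positive
  -- coordinate; it is common to both elements because the global coordinates agree.
  obtain ⟨c, hc⟩ : ∃ c, 0 < bary ξ c := by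
    by_contra! hneg
    have := sum_bary ξ
    have := Finset.sum_nonpos fun c (_ : c ∈ Finset.univ) => hneg c
    linarith
  obtain ⟨c', hc'⟩ : ∃ c', M.node K' c' = M.node K c := by
    by_contra! hne
    rw [← globalBary_apply (M.node K), (M.conforming K K' ξ hξ ξ' hξ').1 h,
      globalBary_eq_zero hne] at hc
    exact lt_irrefl _ hc
  have hsub : ∀ (K : ι) (a b c : Fin 4) (ξ : R3),
      M.tangent K a b ξ = M.tangent K c b ξ - M.tangent K c a ξ := fun K a b c ξ => by
    rw [tangent, tangent, tangent, ← mulVec_sub]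
    congr 1
    abel
  rw [hsub K a b c, hsub K' a' b' c', M.tangent_eq_of_bary_pos hξ hξ' h hc'.symm hb hc,
    M.tangent_eq_of_bary_pos hξ hξ' h hc'.symm ha hc]

end Grid
end Tet

/-! ### Hat functions and their Lipschitz continuity -/

namespace Tet

open Filter Topology NNReal

/-- A function on a convex set that is Lipschitz near each point, with a uniform constant, is
Lipschitz. -/
theorem lipschitzOnWith_of_eventually {E : Type*} [NormedAddCommGroup E] [NormedSpace ℝ E]
    {f : E → ℝ} {s : Set E} (hs : Convex ℝ s) {L : ℝ≥0}
    (h : ∀ x ∈ s, ∀ᶠ y in 𝓝 x, ‖f y - f x‖ ≤ L * ‖y - x‖) : LipschitzOnWith L f s := by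
  refine LipschitzOnWith.of_dist_le_mul fun y hy x hx => ?_
  rw [dist_eq_norm, dist_eq_norm]
  set γ : ℝ → E := fun t => x + t • (y - x) with hγ
  have hγc : Continuous γ := by fun_prop
  have hγs : ∀ t ∈ Set.Icc (0 : ℝ) 1, γ t ∈ s := fun t ht => hs.add_smul_sub_mem hx hy ht
  have hγd : ∀ t u, ‖γ u - γ t‖ = |u - t| * ‖y - x‖ := fun t u => by
    rw [← Real.norm_eq_abs, ← norm_smul]
    congr 1
    simp only [hγ]
    module
  have hfc : ∀ z ∈ s, ContinuousAt f z := fun z hz => by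
    rw [ContinuousAt, tendsto_iff_norm_sub_tendsto_zero]
    refine squeeze_zero' (Eventually.of_forall fun _ => norm_nonneg _) (h z hz) ?_
    have : Continuous fun w : E => (L : ℝ) * ‖w - z‖ := by fun_prop
    simpa using this.tendsto z
  -- Continuous induction along the segment: the set of good t is closed in [0, 1], contains 0 and
  -- extends to the right of each of its points below 1.
  have hsub : Set.Icc (0 : ℝ) 1 ⊆ {t | ‖f (γ t) - f x‖ ≤ L * (t * ‖y - x‖)} := by
    refine IsClosed.Icc_subset_of_forall_mem_nhdsWithin ?_ ?_ ?_
    · rw [Set.inter_comm]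
      have hfγ : ContinuousOn (fun t => f (γ t)) (Set.Icc 0 1) := fun t ht =>
        (ContinuousAt.comp (hfc _ (hγs t ht)) hγc.continuousAt).continuousWithinAt
      exact isClosed_Icc.isClosed_le (hfγ.sub continuousOn_const).norm (by fun_prop)
    · simp [hγ]
    · rintro t ⟨ht, ht0, ht1⟩
      filter_upwards [nhdsWithin_le_nhds
        (hγc.continuousAt.eventually (h _ (hγs t ⟨ht0, ht1.le⟩))), self_mem_nhdsWithin] with u hu htu
      have htu' : t < u := htu
      rw [hγd, abs_of_pos (sub_pos.2 htu')] at hu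
      have ht' : ‖f (γ t) - f x‖ ≤ L * (t * ‖y - x‖) := ht
      calc ‖f (γ u) - f x‖ ≤ ‖f (γ u) - f (γ t)‖ + ‖f (γ t) - f x‖ :=
            norm_sub_le_norm_sub_add_norm_sub _ _ _
        _ ≤ L * ((u - t) * ‖y - x‖) + L * (t * ‖y - x‖) := add_le_add hu ht'
        _ = L * (u * ‖y - x‖) := by ring
  have h1 : ‖f (γ 1) - f x‖ ≤ L * (1 * ‖y - x‖) := hsub ⟨zero_le_one, le_rfl⟩
  simpa [hγ] using h1

namespace Grid

variable {ι : Type*} (M : Grid ι)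

open Classical in
/-- The global barycentric coordinate (the hat function) of the vertex `v`. -/
noncomputable def hat (v : ℕ) (x : R3) : ℝ :=
  if h : ∃ q : ι × R3, q.2 ∈ refTet ∧ M.map q.1 q.2 = x then
    globalBary (M.node h.choose.1) h.choose.2 v
  else 0

/-- By conformity the value does not depend on the chosen element and reference point. -/
theorem hat_map (v : ℕ) (K : ι) {ξ : R3} (hξ : ξ ∈ refTet) :
    M.hat v (M.map K ξ) = globalBary (M.node K) ξ v := by
  have h : ∃ q : ι × R3, q.2 ∈ refTet ∧ M.map q.1 q.2 = M.map K ξ := ⟨(K, ξ), hξ, rfl⟩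
  rw [hat, dif_pos h]
  exact congrFun ((M.conforming _ _ _ h.choose_spec.1 _ hξ).1 h.choose_spec.2) v

/-- The local inverse of the element map shows that the hat function is differentiable. The chain
rule for its pullback, which is affine, then yields the factor J⁻ᵀ. -/
theorem gradient_hat (v : ℕ) (K : ι) {ξ : R3} (hξ : ξ ∈ interior refTet) :
    gradient (M.hat v) (M.map K ξ) =
      piola (M.map K) (fun _ => globalGrad (M.node K) v) ξ := by
  have hξ' := interior_subset hξ
  obtain ⟨A, hA⟩ := M.exists_continuousLinearEquiv K hξ'
  have hs : HasStrictFDerivAt (M.map K) (A : R3 →L[ℝ] R3) ξ := hA ▸ M.hasStrictFDerivAt K hξ'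
  have hloc : M.hat v =ᶠ[𝓝 (M.map K ξ)]
      fun y => globalBary (M.node K) (hs.localInverse _ _ _ y) v := by
    filter_upwards [hs.eventually_right_inverse,
      hs.localInverse_tendsto.eventually (isOpen_interior.mem_nhds hξ)] with y hy hy'
    conv_lhs => rw [← hy]
    exact M.hat_map v K (interior_subset hy')
  have hd : DifferentiableAt ℝ (M.hat v) (M.map K ξ) := by
    refine DifferentiableAt.congr_of_eventuallyEq ?_ hloc
    exact (hasFDerivAt_globalBary (M.node K) v _).differentiableAt.comp _
      hs.to_localInverse.hasFDerivAt.differentiableAt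
  have hcomp : (fderiv ℝ (M.hat v) (M.map K ξ)).comp (fderiv ℝ (M.map K) ξ) =
      globalGradL (M.node K) v := by
    refine HasFDerivAt.unique (hd.hasFDerivAt.comp ξ (M.hasStrictFDerivAt K hξ').hasFDerivAt) ?_
    refine (hasFDerivAt_globalBary (M.node K) v ξ).congr_of_eventuallyEq ?_
    filter_upwards [isOpen_interior.mem_nhds hξ] with η hη
    exact M.hat_map v K (interior_subset hη)
  have hgrad : ∀ w, gradient (M.hat v) (M.map K ξ) ⬝ᵥ w =
      fderiv ℝ (M.hat v) (M.map K ξ) w := fun w => by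
    conv_rhs => rw [pi_eq_sum_univ' w, map_sum]
    refine Finset.sum_congr rfl fun i _ => ?_
    rw [map_smul, smul_eq_mul, mul_comm]
    rfl
  have hdet := isUnit_iff_ne_zero.2 (M.det_ne_zero K ξ hξ')
  have key : globalGrad (M.node K) v =
      gradient (M.hat v) (M.map K ξ) ᵥ* jacobian (M.map K) ξ := by
    refine dotProduct_eq _ _ fun w => ?_
    rw [← dotProduct_mulVec, jacobian_mulVec, hgrad, ← globalGradL_apply, ← hcomp]
    rfl
  rw [piola, key, mulVec_transpose, vecMul_vecMul, mul_nonsing_inv _ hdet, vecMul_one]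

theorem exists_abs_hat_sub_le [Finite ι] (v : ℕ) : ∃ L : ℝ≥0, ∀ K, ∀ x ∈ M.map K '' refTet,
    ∀ y ∈ M.map K '' refTet, ‖M.hat v y - M.hat v x‖ ≤ L * ‖y - x‖ := by
  have hK : ∀ K, ∃ L : ℝ≥0, ∀ x ∈ M.map K '' refTet,
      ∀ y ∈ M.map K '' refTet, ‖M.hat v y - M.hat v x‖ ≤ L * ‖y - x‖ := fun K => by
    obtain ⟨C, hC⟩ := M.exists_norm_sub_le K
    refine ⟨(‖globalGradL (M.node K) v‖ * |C|).toNNReal, ?_⟩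
    rintro _ ⟨ξ, hξ, rfl⟩ _ ⟨η, hη, rfl⟩
    rw [M.hat_map v K hξ, M.hat_map v K hη, Real.coe_toNNReal _ (by positivity),
      globalBary_eq _ η, globalBary_eq _ ξ, add_sub_add_left_eq_sub, ← globalGradL_apply,
      ← globalGradL_apply, ← map_sub, mul_assoc]
    refine (ContinuousLinearMap.le_opNorm _ _).trans ?_
    gcongr
    exact (hC η hη ξ hξ).trans (by gcongr; exact le_abs_self C)
  choose L hL using hK
  obtain ⟨B, hB⟩ := (Set.finite_range L).bddAbove
  refine ⟨B, fun K x hx y hy => (hL K x hx y hy).trans ?_⟩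
  gcongr
  exact hB (Set.mem_range_self K)

/-- The finitely many elements are closed, so every element containing a point y close enough to x
also contains x, and the estimate on that element applies. Only pairs with the fixed point x are
covered, which is what `lipschitzOnWith_of_eventually` takes as input. -/
theorem exists_eventually_abs_hat_sub_le [Finite ι] {V : Set R3} (hV : IsOpen V)
    (hcover : closure V = ⋃ K, M.map K '' refTet) (v : ℕ) :
    ∃ L : ℝ≥0, ∀ x ∈ V, ∀ᶠ y in 𝓝 x, ‖M.hat v y - M.hat v x‖ ≤ L * ‖y - x‖ := by
  obtain ⟨L, hL⟩ := M.exists_abs_hat_sub_le v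
  refine ⟨L, fun x hx => ?_⟩
  have h : ∀ᶠ y in 𝓝 x, ∀ K, y ∈ M.map K '' refTet → x ∈ M.map K '' refTet := by
    refine eventually_all.2 fun K => ?_
    by_cases hxK : x ∈ M.map K '' refTet
    · exact Eventually.of_forall fun _ _ => hxK
    · filter_upwards [(isCompact_refTet.image_of_continuousOn
        (M.continuousOn_map K)).isClosed.isOpen_compl.mem_nhds hxK] with y hy hy'
      exact absurd hy' hy
  filter_upwards [h, hV.mem_nhds hx] with y hy hyV
  have hyc := subset_closure hyV
  rw [hcover, Set.mem_iUnion] at hyc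
  obtain ⟨K, hyK⟩ := hyc
  exact hL K x (hy K hyK) y hyK

/-! ### Piecewise defined functions -/

/-- At an interior point all barycentric coordinates are positive, so the global coordinates reveal
the whole vertex set. -/
theorem eq_of_map_eq {K K' : ι} {ξ ξ' : R3} (hξ : ξ ∈ interior refTet)
    (hξ' : ξ' ∈ interior refTet) (h : M.map K ξ = M.map K' ξ') : K = K' := by
  have hg := (M.conforming K K' ξ (interior_subset hξ) ξ' (interior_subset hξ')).1 h
  have key : ∀ {K K' : ι} {ξ ξ' : R3}, ξ ∈ interior refTet →
      globalBary (M.node K) ξ = globalBary (M.node K') ξ' →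
        Set.range (M.node K) ⊆ Set.range (M.node K') := by
    rintro K K' ξ ξ' hξ hg _ ⟨a, rfl⟩
    by_contra hne
    have hpos := bary_pos_of_mem_interior hξ a
    rw [← globalBary_apply (M.node K), hg, globalBary_eq_zero fun c hc => hne ⟨c, hc⟩] at hpos
    exact lt_irrefl _ hpos
  exact M.node_injective ((key hξ hg).antisymm (key hξ' hg.symm))

theorem glue_map [Fintype ι] {E : Type*} [AddCommMonoid E] (w : ι → R3 → E) (K : ι) {ξ : R3}
    (hξ : ξ ∈ interior refTet) : M.glue w (M.map K ξ) = w K ξ := by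
  have hξ' := interior_subset hξ
  rw [glue, Finset.sum_eq_single K]
  · rw [Set.indicator_of_mem (Set.mem_image_of_mem _ hξ)]
    have hmem : ∃ η ∈ refTet, M.map K η = M.map K ξ := ⟨ξ, hξ', rfl⟩
    rw [M.injOn K (Function.invFunOn_mem hmem) hξ' (Function.invFunOn_eq hmem)]
  · rintro K' - hne
    refine Set.indicator_of_notMem ?_ _
    rintro ⟨ξ', hξ'', h⟩
    exact hne (M.eq_of_map_eq hξ'' hξ h)
  · simp

theorem ae_mem_image_interior [Finite ι] {V : Set R3} (hV : IsOpen V)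
    (hcover : closure V = ⋃ K, M.map K '' refTet) :
    ∀ᵐ x ∂volume.restrict V, ∃ K, x ∈ M.map K '' interior refTet := by
  -- The frontier of a convex set is null, and differentiable maps preserve null sets.
  have hnull : volume (⋃ K, M.map K '' frontier refTet) = 0 := by
    refine measure_iUnion_null fun K => ?_
    refine addHaar_image_eq_zero_of_differentiableOn_of_addHaar_eq_zero _ (fun ξ hξ => ?_)
      (convex_refTet.addHaar_frontier _)
    exact (M.hasStrictFDerivAt K
      (isClosed_refTet.frontier_subset hξ)).differentiableAt.differentiableWithinAt
  filter_upwards [ae_restrict_mem hV.measurableSet,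
    ae_restrict_of_ae (measure_eq_zero_iff_ae_notMem.1 hnull)] with x hx hx'
  have hxc := subset_closure hx
  rw [hcover, Set.mem_iUnion] at hxc
  obtain ⟨K, ξ, hξ, rfl⟩ := hxc
  refine ⟨K, ξ, ?_, rfl⟩
  by_contra hi
  exact hx' (Set.mem_iUnion.2 ⟨K, ξ, ⟨subset_closure hξ, hi⟩, rfl⟩)

variable {M} in
/-- A vectorial base function is in `H(curl)` if its scalar factor is in `H¹`. -/
theorem IsBaseIndex.glue_mem_HCurl [Fintype ι] {p : ℕ} {U : PolytopalBasis p} {V : Set R3}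
    (hV : IsOpen V) (hcover : closure V = ⋃ K, M.map K '' refTet) {S F : Finset ℕ} {m r : ℕ}
    (h : M.IsBaseIndex p S F m r) (hu : M.glue (M.localScalar U S m) ∈ H1 V) :
    M.glue (M.localField U S F m r) ∈ HCurl V := by
  obtain ⟨v, hv⟩ := h.exists_isTemplateVertex
  obtain ⟨L, hL⟩ := M.exists_eventually_abs_hat_sub_le hV hcover v
  -- The sign is absorbed into the scalar factor.
  refine mem_HCurl_of_ae_eq hV (u := (vertexSign S v : ℝ) • M.glue (M.localScalar U S m))
    (Λ := M.hat v) (L := L) ((H1 V).smul_mem _ hu) ?_ ?_ ?_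
  · intro x hx
    obtain ⟨ε, hε, hb⟩ := Metric.isOpen_iff.1 hV x hx
    exact ⟨L, Metric.ball x ε, mem_nhdsWithin_of_mem_nhds (Metric.ball_mem_nhds x hε),
      lipschitzOnWith_of_eventually (convex_ball x ε) fun y hy => hL y (hb hy)⟩
  · exact fun x hx => norm_fderiv_le_of_lip' ℝ L.2 (hL x hx)
  · filter_upwards [M.ae_mem_image_interior hV hcover] with x hx
    obtain ⟨K, ξ, hξ, rfl⟩ := hx
    rw [Pi.smul_apply, M.glue_map _ K hξ, M.glue_map _ K hξ, M.gradient_hat v K hξ, smul_eq_mul]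
    by_cases hvK : v ∈ M.nodes K
    · obtain ⟨i, rfl⟩ := M.mem_nodes.1 hvK
      rw [M.localField_eq U h.1 hv, globalGrad_apply]
    · rw [M.localField_eq_zero U hv hvK,
        globalGrad_eq_zero fun a ha => hvK (M.mem_nodes.2 ⟨a, ha⟩)]
      simp [piola]

theorem nedelecSpace_le_HCurl [Fintype ι] {p : ℕ} {U : PolytopalBasis p} {V : Set R3}
    (hV : IsOpen V) (hcover : closure V = ⋃ K, M.map K '' refTet)
    (hU : M.scalarSpace U ≤ H1 V) : M.nedelecSpace U ≤ HCurl V := by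
  refine Submodule.span_le.2 ?_
  rintro _ ⟨S, F, m, r, h, rfl⟩
  refine h.glue_mem_HCurl hV hcover (hU (Submodule.subset_span ⟨S, m, ?_, rfl⟩))
  obtain ⟨hk, hm, K, hF, -⟩ := h
  refine ⟨Finset.card_pos.1 ?_, hm, K, hk.1.trans hF⟩
  have := hk.2
  omega

end Grid
end Tet

/-! ### Conformity and tangential traces -/

theorem mainTheorem10 {ι : Type*} [Fintype ι] (p : ℕ) (hp : 1 ≤ p) (U : Tet.PolytopalBasis p)
    (M : Tet.Grid ι) (V : Set R3) (hV : IsOpen V)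
    (hcover : closure V = ⋃ K, M.map K '' Tet.refTet)
    (hU : M.scalarSpace U ≤ Tet.H1 V) :
    M.nedelecSpace U ≤ Tet.HCurl V ∧
    ∀ (S F : Finset ℕ) (m r : ℕ), M.IsBaseIndex p S F m r →
      -- the tangential trace vanishes on all boundary polytopes that do not contain `F`
      (∀ (K : ι) (g : Finset (Fin 4)), g ≠ Finset.univ → ¬ (F ⊆ M.nodes K ∧ M.loc K F ⊆ g) →
        ∀ a ∈ g, ∀ b ∈ g, ∀ ξ ∈ Tet.polytope g,
          M.tangent K a b ξ ⬝ᵥ M.localField U S F m r K ξ = 0) ∧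
      -- on its edge, the tangential trace of an edge-type function is the scalar trace
      (∀ (K : ι) (a b : Fin 4), a < b → F = {M.node K a, M.node K b} →
        ∀ ξ ∈ Tet.polytope {a, b},
          M.tangent K a b ξ ⬝ᵥ M.localField U S F m r K ξ = M.localScalar U S m K ξ) ∧
      -- on its face, the tangential trace of a face-type function is a constant tangential
      -- covector, nonzero on the face, times the scalar trace
      (F.card = 3 → ∃ c : ℕ → ℕ → ℝ, (∃ v ∈ F, ∃ w ∈ F, c v w = 1) ∧
        ∀ K, F ⊆ M.nodes K → ∀ a ∈ M.loc K F, ∀ b ∈ M.loc K F, ∀ ξ ∈ Tet.polytope (M.loc K F),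
          M.tangent K a b ξ ⬝ᵥ M.localField U S F m r K ξ =
            c (M.node K a) (M.node K b) * M.localScalar U S m K ξ) ∧
      -- on the interface of two elements, the tangential components of the two one-sided traces
      -- are one and the same constant multiple of the two one-sided scalar traces
      (∀ K K' : ι, K ≠ K' → ∀ a b a' b' : Fin 4,
        M.node K a = M.node K' a' → M.node K b = M.node K' b' →
        ∃ c : ℝ, ∀ ξ ∈ Tet.refTet, ∀ ξ' ∈ Tet.refTet, M.map K ξ = M.map K' ξ' →
          M.tangent K a b ξ = M.tangent K' a' b' ξ' ∧
          M.tangent K a b ξ ⬝ᵥ M.localField U S F m r K ξ = c * M.localScalar U S m K ξ ∧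
          M.tangent K' a' b' ξ' ⬝ᵥ M.localField U S F m r K' ξ' =
            c * M.localScalar U S m K' ξ') := by
  refine ⟨M.nedelecSpace_le_HCurl hV hcover hU, fun S F m r h => ?_⟩
  obtain ⟨v, hv⟩ := h.exists_isTemplateVertex
  obtain ⟨hk, hm, -⟩ := h
  have htan := M.tangent_dotProduct_localField (m := m) U hk hv
  have hvF : v ∈ F := by
    rw [hv.1]
    exact Finset.mem_insert_self _ _
  refine ⟨fun K g _ hg a ha b hb ξ hξ => ?_, fun K a b hab hF ξ hξ => ?_, fun hF => ?_,
    fun K K' _ a b a' b' ha hb => ⟨_, fun ξ hξ ξ' hξ' hmap =>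
      ⟨M.tangent_eq hξ hξ' hmap ha hb, htan K a b hξ, ?_⟩⟩⟩
  · rw [htan K a b hξ.1]
    by_cases hFK : F ⊆ M.nodes K
    · obtain ⟨i, rfl⟩ := M.mem_nodes.1 (hFK hvF)
      have hne : S.Nonempty := Finset.card_pos.1 (by have := hk.2; omega)
      have hcard : Tet.polytopeDim p (M.loc K S) = Tet.polytopeDim p S := by
        conv_rhs => rw [Tet.polytopeDim, ← M.loc_map K (hk.1.trans hFK), Finset.card_map]
        rfl
      -- If v lies in g, then S does not, since F = S ∪ {v} does not; so the scalar factor vanishes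
      -- on g. Otherwise a and b both differ from v, and the coefficient δ_vb − δ_va is zero.
      by_cases hi : i ∈ g
      · have hS : ¬ M.loc K S ⊆ g := fun hS => hg ⟨hFK, fun c hc => by
          rw [M.mem_loc, hv.1, Finset.mem_insert] at hc
          rcases hc with hc | hc
          · rwa [(M.node K).injective hc]
          · exact hS (M.mem_loc.2 hc)⟩
        rw [Tet.Grid.localScalar, if_pos (hk.1.trans hFK), U.vanish _ m ?_ (hcard ▸ hm) g hS ξ hξ,
          mul_zero]
        rw [← Finset.map_nonempty (f := (M.node K).toEmbedding), M.loc_map K (hk.1.trans hFK)]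
        exact hne
      · simp [(ne_of_mem_of_not_mem ha hi).symm, (ne_of_mem_of_not_mem hb hi).symm]
    · by_cases hvK : v ∈ M.nodes K
      · have hS : ¬ S ⊆ M.nodes K := fun hS => hFK (by
          rw [hv.1, Finset.insert_subset_iff]
          exact ⟨hvK, hS⟩)
        rw [Tet.Grid.localScalar, if_neg hS, mul_zero]
      · have : ∀ c, v ≠ M.node K c := fun c hc => hvK (M.mem_nodes.2 ⟨c, hc.symm⟩)
        simp [this]
  · rw [htan K a b hξ.1]
    rw [M.vertexSign_mul_edge hk hv hab hF, one_mul]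
  · refine ⟨fun x y => Tet.vertexSign S v * ((if v = y then 1 else 0) - (if v = x then 1 else 0)),
      ?_, fun K _ a _ b _ ξ hξ => htan K a b hξ.1⟩
    -- Any edge of F at v has coefficient ±1; the sign of the template vector decides the
    -- orientation that gives 1.
    obtain ⟨w, hw, hwv⟩ := Finset.exists_mem_ne (by omega : 1 < F.card) v
    rcases Tet.vertexSign_eq S v with hs | hs
    · exact ⟨w, hw, v, hvF, by simp [hs, hwv.symm]⟩
    · exact ⟨v, hvF, w, hw, by simp [hs, hwv.symm]⟩
  -- The coefficient involves only global vertex numbers, so both elements have the same one.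
  · rw [htan K' a' b' hξ', ha, hb]
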